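/- **Proposition (Stability and uniqueness).** Let $N$ be a compact smooth Riemannian manifold without boundary, with Levi-Civita connection $\nabla$ and curvature tensor $R^N$ (in either sign convention $R^N(X,Y)Z=\pm(\nabla_X\nabla_YZ-\nabla_Y\nabla_XZ-\nabla_{[X,Y]}Z)$). Let $S^1=\mathbb R/2\pi\mathbb Z$ carry a fixed spin structure, so that spinors on $S^1$ are the functions $\mathbb R\to\mathbb C$ satisfying $\psi(s+2\pi)=\psi(s)$ or, for the other spin structure, $\psi(s+2\pi)=-\psi(s)$; Clifford multiplication $\partial_s\cdot$ is multiplication by $i$, and $\langle z,w\rangle=\mathrm{Re}(\bar z w)$. For a curve $\gamma\colon S^1\to N$ let $\tilde\nabla$ be the induced connection on the twisted bundle $\Sigma S^1\otimes_{\mathbb R}\gamma^{-1}TN$, and put $'=\partial_s$. For a section $\psi$ of this bundle define $$\tau(\gamma)=\nabla_{\partial_s}\gamma',\quad \slashed{D}\psi=\partial_s\cdot\tilde\nabla_{\partial_s}\psi,\quad \tilde\Delta\psi=\tilde\nabla_{\partial_s}\tilde\nabla_{\partial_s}\psi,$$ $$\mathcal R(\gamma,\psi)=\tfrac12R^N(\partial_s\cdot\psi,\psi)\gamma',\qquad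 \mathcal R_c(\gamma,\psi)=R^N(\tilde\nabla_{\partial_s}\psi,\psi)\gamma',$$ where $R^N(\varphi,\psi)Z=\sum_{i,j}\langle\varphi^i,\psi^j\rangle R^N(\partial_{y^i},\partial_{y^j})Z$ for $\varphi=\sum_i\varphi^i\otimes\partial_{y^i}$ and $\psi=\sum_j\psi^j\otimes\partial_{y^j}$. Let $\epsilon>0$ and $0<T\le\infty$, and let $(\gamma_t,\psi_t)$ and $(\tilde\gamma_t,\tilde\psi_t)$ be two solutions, smooth on $S^1\times[0,T)$, of $$\frac{\partial\gamma_t}{\partial t}=\tau(\gamma_t)-\mathcal R(\gamma_t,\psi_t)-\epsilon\,\mathcal R_c(\gamma_t,\psi_t),\qquad \frac{\tilde\nabla\psi_t}{\partial t}=\tilde\Delta\psi_t-\frac1\epsilon\slashed{D}\psi_t,$$ where $\psi_t$ is a section of $\Sigma S^1\otimes\gamma_t^{-1}TN$ and $\tilde\psi_t$ a section of $\Sigma S^1\otimes\tilde\gamma_t^{-1}TN$. If the initial data coincide, $(\gamma_0,\psi_0)=(\tilde\gamma_0,\tilde\psi_0)$, then $(\gamma_t,\psi_t)=(\tilde\gamma_t,\tilde\psi_t)$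 throughout $S^1\times[0,T)$. -/

import Mathlib

open Bundle Manifold
open scoped ContDiff

noncomputable section

namespace DiracFlow

section Geometry

variable {n : ℕ} {N : Type*} [TopologicalSpace N] [ChartedSpace (EuclideanSpace ℝ (Fin n)) N]
  [IsManifold (𝓡 n) ∞ N]

/-- The components `(v¹, …, vⁿ)` of a tangent vector `v ∈ T_p N` with respect to the coordinate
chart `y` of `N` around `x₀`, i.e. the image of `v` under the differential of that chart. -/
def toCoord (x₀ p : N) (v : TangentSpace (𝓡 n) p) : EuclideanSpace ℝ (Fin n) :=
  (trivializationAt (EuclideanSpace ℝ (Fin n)) (TangentSpace (𝓡 n) : N → Type _) x₀)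
    |>.continuousLinearMapAt ℝ p v

/-- The tangent vector `∑ wⁱ ∂/∂yⁱ ∈ T_p N` with components `w` in the chart around `x₀`. -/
def ofCoord (x₀ p : N) (w : EuclideanSpace ℝ (Fin n)) : TangentSpace (𝓡 n) p :=
  (trivializationAt (EuclideanSpace ℝ (Fin n)) (TangentSpace (𝓡 n) : N → Type _) x₀)
    |>.symmL ℝ p w

/-- `toCoord` is the differential of the coordinate chart. -/
theorem toCoord_eq_mfderiv (x₀ p : N) (hp : p ∈ (chartAt (EuclideanSpace ℝ (Fin n)) x₀).source)
    (v : TangentSpace (𝓡 n) p) :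
    toCoord x₀ p v =
      mfderiv (𝓡 n) 𝓘(ℝ, EuclideanSpace ℝ (Fin n)) (extChartAt (𝓡 n) x₀) p v := by
  unfold toCoord
  rw [TangentBundle.continuousLinearMapAt_trivializationAt hp]
  rfl

/-- `∂f/∂yⁱ` for a function of the coordinates. -/
def pderiv (i : Fin n) (f : EuclideanSpace ℝ (Fin n) → ℝ) (y : EuclideanSpace ℝ (Fin n)) : ℝ :=
  fderiv ℝ f y (EuclideanSpace.single i 1)

variable [RiemannianBundle (fun x : N ↦ TangentSpace (𝓡 n) x)]

/-- The matrix `g_{ij}(y) = ⟨∂/∂yⁱ, ∂/∂yʲ⟩` of the Riemannian metric in the chart around `x₀`, as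
a function of the coordinates `y`. -/
def metricCoeff (x₀ : N) (y : EuclideanSpace ℝ (Fin n)) : Matrix (Fin n) (Fin n) ℝ :=
  fun i j ↦ inner ℝ
    (ofCoord x₀ ((extChartAt (𝓡 n) x₀).symm y) (EuclideanSpace.single i 1))
    (ofCoord x₀ ((extChartAt (𝓡 n) x₀).symm y) (EuclideanSpace.single j 1))

/-- The Christoffel symbol `Γᵏ_{ij}(y)` of the Levi-Civita connection in the chart around `x₀`. -/
def christoffel (x₀ : N) (k i j : Fin n) (y : EuclideanSpace ℝ (Fin n)) : ℝ :=
  (1 / 2 : ℝ) * ∑ l, (metricCoeff x₀ y)⁻¹ k l *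
    (pderiv i (fun z ↦ metricCoeff x₀ z j l) y + pderiv j (fun z ↦ metricCoeff x₀ z i l) y
      - pderiv l (fun z ↦ metricCoeff x₀ z i j) y)

/-- The component `Rᵐ_{lij}(y)` of the curvature tensor, `R(∂_i, ∂_j) ∂_l = ∑ₘ Rᵐ_{lij} ∂_m`, in
the chart around `x₀`, for `R(X,Y)Z = ∇_X ∇_Y Z - ∇_Y ∇_X Z - ∇_{[X,Y]} Z`. -/
def riemannCoeff (x₀ : N) (m l i j : Fin n) (y : EuclideanSpace ℝ (Fin n)) : ℝ :=
  pderiv i (christoffel x₀ m j l) y - pderiv j (christoffel x₀ m i l) y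
    + ∑ r, (christoffel x₀ m i r y * christoffel x₀ r j l y
        - christoffel x₀ m j r y * christoffel x₀ r i l y)

/-- The curvature tensor `R(X, Y) Z = ∇_X ∇_Y Z - ∇_Y ∇_X Z - ∇_{[X,Y]} Z` at the point `p`
(computed in the chart around `p`). -/
def curvature (p : N) (X Y Z : TangentSpace (𝓡 n) p) : TangentSpace (𝓡 n) p :=
  ofCoord p p <| WithLp.toLp 2 fun m ↦ ∑ l, ∑ i, ∑ j,
    riemannCoeff p m l i j (extChartAt (𝓡 n) p p) *
      toCoord p p X i * toCoord p p Y j * toCoord p p Z l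

/-- The velocity `c'(τ) ∈ T_{c(τ)} N` of a curve in `N`. -/
def velocity (c : ℝ → N) (τ : ℝ) : TangentSpace (𝓡 n) (c τ) :=
  mfderiv 𝓘(ℝ, ℝ) (𝓡 n) c τ (1 : ℝ)

/-- The covariant derivative `∇V/dτ` of a vector field `V` along a curve `c` in `N`, that is the
connection on `c⁻¹TN` induced by the Levi-Civita connection. In the chart around `c(τ)` it is
`(∇V/dτ)ᵏ = dVᵏ/dτ + ∑_{i,j} Γᵏ_{ij}(c) (dcⁱ/dτ) Vʲ`. -/
def covDeriv (c : ℝ → N) (V : ∀ τ, TangentSpace (𝓡 n) (c τ)) (τ : ℝ) :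
    TangentSpace (𝓡 n) (c τ) :=
  ofCoord (c τ) (c τ) <| deriv (fun τ' ↦ toCoord (c τ) (c τ') (V τ')) τ +
    WithLp.toLp 2 fun k ↦ ∑ i, ∑ j, christoffel (c τ) k i j (extChartAt (𝓡 n) (c τ) (c τ)) *
      deriv (fun τ' ↦ extChartAt (𝓡 n) (c τ) (c τ')) τ i * toCoord (c τ) (c τ) (V τ) j

end Geometry

section Spinors

/-- The two spin structures on `S¹ = ℝ / 2πℤ`: spinors are the complex valued functions on `ℝ` that
are `2π`-periodic, respectively `2π`-antiperiodic. -/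
inductive SpinStructure
  | periodic
  | antiperiodic

/-- The sign in `ψ(s + 2π) = ± ψ(s)`. -/
def SpinStructure.sign : SpinStructure → ℝ
  | .periodic => 1
  | .antiperiodic => -1

variable {n : ℕ} {N : Type*} [TopologicalSpace N] [ChartedSpace (EuclideanSpace ℝ (Fin n)) N]
  [IsManifold (𝓡 n) ∞ N]

variable (n) in
/-- The fibre `ℂ ⊗_ℝ T_p N` over a point `p = γ(s)` of the twisted bundle `ΣS¹ ⊗ γ⁻¹TN`. The pair
`(a, b)` stands for `1 ⊗ a + i ⊗ b`. -/
abbrev TwistedFibre (p : N) : Type := TangentSpace (𝓡 n) p × TangentSpace (𝓡 n) p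

/-- Clifford multiplication `∂_s ·`, i.e. multiplication by the imaginary unit. -/
def clifford {p : N} (ψ : TwistedFibre n p) : TwistedFibre n p := (-ψ.2, ψ.1)

variable [RiemannianBundle (fun x : N ↦ TangentSpace (𝓡 n) x)]

/-- `R(φ, ψ) Z = ∑_{i,j} ⟨φⁱ, ψʲ⟩ R(∂_i, ∂_j) Z` for `φ = φⁱ ⊗ ∂_i`, `ψ = ψʲ ⊗ ∂_j` in `ℂ ⊗ T_p N`,
where `⟨z, w⟩ = Re (z̄ w)` is the real scalar product on spinors. -/
def spinorCurvature (p : N) (φ ψ : TwistedFibre n p) (Z : TangentSpace (𝓡 n) p) :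
    TangentSpace (𝓡 n) p :=
  curvature p φ.1 ψ.1 Z + curvature p φ.2 ψ.2 Z

/-- The connection `∇̃` on `ΣS¹ ⊗ c⁻¹TN` along a curve `c`: the flat connection on spinors, twisted
by the connection on `c⁻¹TN`. -/
def spinorCovDeriv (c : ℝ → N) (ψ : ∀ τ, TwistedFibre n (c τ)) (τ : ℝ) : TwistedFibre n (c τ) :=
  (covDeriv c (fun τ' ↦ (ψ τ').1) τ, covDeriv c (fun τ' ↦ (ψ τ').2) τ)

/-- The tension field `τ(γ) = ∇_s γ'`. -/
def tension (γ : ℝ → N) (s : ℝ) : TangentSpace (𝓡 n) (γ s) :=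
  covDeriv γ (velocity γ) s

/-- The twisted Dirac operator `D̸ψ = ∂_s · ∇̃ψ`. -/
def dirac (γ : ℝ → N) (ψ : ∀ s, TwistedFibre n (γ s)) (s : ℝ) : TwistedFibre n (γ s) :=
  clifford (spinorCovDeriv γ ψ s)

/-- The connection Laplacian `Δ̃ψ = ∇̃_s ∇̃_s ψ`. -/
def spinorLaplacian (γ : ℝ → N) (ψ : ∀ s, TwistedFibre n (γ s)) (s : ℝ) : TwistedFibre n (γ s) :=
  spinorCovDeriv γ (spinorCovDeriv γ ψ) s

/-- `𝓡(γ, ψ) = ½ R(∂_s · ψ, ψ) γ'`. -/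
def curvTerm (γ : ℝ → N) (ψ : ∀ s, TwistedFibre n (γ s)) (s : ℝ) : TangentSpace (𝓡 n) (γ s) :=
  (1 / 2 : ℝ) • spinorCurvature (γ s) (clifford (ψ s)) (ψ s) (velocity γ s)

/-- `𝓡_c(γ, ψ) = R(∇̃ψ, ψ) γ'`. -/
def curvTermC (γ : ℝ → N) (ψ : ∀ s, TwistedFibre n (γ s)) (s : ℝ) : TangentSpace (𝓡 n) (γ s) :=
  spinorCurvature (γ s) (spinorCovDeriv γ ψ s) (ψ s) (velocity γ s)

/-- The time interval `[0, T)`, where `T = ∞` is allowed. -/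
def timeInterval (T : EReal) : Set ℝ := {t | 0 ≤ t ∧ (t : EReal) < T}

/-- `(γ, ψ)` is a smooth solution on `S¹ × [0, T)` of the rescaled flow
`∂γ/∂t = τ(γ) - 𝓡(γ, ψ) - ε 𝓡_c(γ, ψ)`, `∇̃ψ/∂t = Δ̃ψ - (1/ε) D̸ψ`,
for the spin structure `σ`. Maps on `S¹` and sections over `S¹` are written as functions of
`s ∈ ℝ` with the appropriate periodicity. The sign `κ = ± 1` is the sign convention for the
curvature tensor of `N`: the one that enters in `𝓡` and `𝓡_c` is `κ` times `curvature`. The values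
of `γ` and `ψ` at times outside `[0, T)` play no role. The equations are asked for at interior
times `t > 0`; as all terms extend continuously to `t = 0`, they then hold there as well. -/
structure IsSmoothSolution (σ : SpinStructure) (κ ε : ℝ) (T : EReal)
    (γ : ℝ → ℝ → N) (ψ : ∀ s t, TwistedFibre n (γ s t)) : Prop where
  smooth_curve : ContMDiffOn 𝓘(ℝ, ℝ × ℝ) (𝓡 n) ∞ (fun q : ℝ × ℝ ↦ γ q.1 q.2)
    (Set.univ ×ˢ timeInterval T)
  smooth_spinor_re : ContMDiffOn 𝓘(ℝ, ℝ × ℝ) (𝓡 n).tangent ∞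
    (fun q : ℝ × ℝ ↦ (⟨γ q.1 q.2, (ψ q.1 q.2).1⟩ : TangentBundle (𝓡 n) N))
    (Set.univ ×ˢ timeInterval T)
  smooth_spinor_im : ContMDiffOn 𝓘(ℝ, ℝ × ℝ) (𝓡 n).tangent ∞
    (fun q : ℝ × ℝ ↦ (⟨γ q.1 q.2, (ψ q.1 q.2).2⟩ : TangentBundle (𝓡 n) N))
    (Set.univ ×ˢ timeInterval T)
  periodic : ∀ s, ∀ t ∈ timeInterval T,
    (⟨γ (s + 2 * Real.pi) t, ψ (s + 2 * Real.pi) t⟩ : Σ p : N, TwistedFibre n p) =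
      ⟨γ s t, σ.sign • ψ s t⟩
  evolution_curve : ∀ s, ∀ t ∈ timeInterval T, 0 < t →
    velocity (fun t' ↦ γ s t') t =
      tension (fun s' ↦ γ s' t) s
        - κ • curvTerm (fun s' ↦ γ s' t) (fun s' ↦ ψ s' t) s
        - ε • κ • curvTermC (fun s' ↦ γ s' t) (fun s' ↦ ψ s' t) s
  evolution_spinor : ∀ s, ∀ t ∈ timeInterval T, 0 < t →
    spinorCovDeriv (fun t' ↦ γ s t') (fun t' ↦ ψ s t') t =
      spinorLaplacian (fun s' ↦ γ s' t) (fun s' ↦ ψ s' t) s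
        - (1 / ε) • dirac (fun s' ↦ γ s' t) (fun s' ↦ ψ s' t) s

end Spinors

end DiracFlow

end

/-! Seen in a Euclidean space the flow is a semilinear heat equation, and uniqueness is the maximum
principle for the squared distance between two solutions. Compactness gives an embedding e of N into
some ℝᵐ. A point p with spinor (a, b) over it becomes the vector (e(p), de a, de b). This assignment
is injective, so it suffices that the difference W of the two image maps vanishes. If |W_t - W_ss| ≤
C(|W| + |W_s|) up to a given time, then |W|² is a subsolution of a linear heat equation with zero
initial values, hence W = 0 (`nonpos_of_heat_inequality`, `eq_zero_of_heat_operator_bound`).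

By compactness the estimate is needed only near each point of space-time. Where W or W_s is nonzero
it follows from continuity. Where both vanish, the two solutions have the same base point, spinor
and s-derivatives there, so nearby both lie in one chart; the geometry of N never has to be extended
to the ambient space. In the chart, z = (y, a, b) satisfies z_t = z_ss + F(z, z_s) with F smooth
(`dt_coordState`): the second derivative of the curve hidden in the spinor Laplacian cancels against
the covariant time derivative. For u = H(z), with H the embedding in the chart, u_t - u_ss = DH(F) -
D²H(z_s, z_s) is a smooth function of (z, z_s). Since (z, p) ↦ (H(z), DH(z)p) is an immersion, that
function is locally Lipschitz in (u, u_s) (`exists_norm_sub_le_of_immersion`,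
`exists_heat_operator_bound`).

Covariant derivative and curvature are defined at each point through the chart centred there.
Working in one fixed chart requires their independence of the chart. It follows from the
transformation law of the Christoffel symbols, which is read off from the Koszul formula
(`christoffelLaw_at`, `toCoord_covDeriv`, `toCoord_curvature`). -/

noncomputable section

namespace DiracFlow

open Set Filter Topology

set_option linter.unusedSectionVars false

/-! ### Partial derivatives on a space-time strip. -/

section SliceDerivatives

variable {X Y : Type*} [NormedAddCommGroup X] [NormedSpace ℝ X]
  [NormedAddCommGroup Y] [NormedSpace ℝ Y]

/-- The partial derivative `∂f/∂s` of a function of `(s, t)`. -/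
def ds (f : ℝ × ℝ → X) (q : ℝ × ℝ) : X := deriv (fun s ↦ f (s, q.2)) q.1

/-- The partial derivative `∂f/∂t` of a function of `(s, t)`. -/
def dt (f : ℝ × ℝ → X) (q : ℝ × ℝ) : X := deriv (fun t ↦ f (q.1, t)) q.2

/-- The strip is unrestricted in s, so the s-derivative is two-sided even on the initial line t = 0.
The t-derivative is two-sided only where J is a neighbourhood of the time. -/
theorem hasDerivAt_slice_fst {J : Set ℝ} {f : ℝ × ℝ → X} {q : ℝ × ℝ}
    (hf : DifferentiableWithinAt ℝ f (univ ×ˢ J) q) (hq : q.2 ∈ J) :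
    HasDerivAt (fun s ↦ f (s, q.2)) (fderivWithin ℝ f (univ ×ˢ J) q (1, 0)) q.1 := by
  have h1 : HasDerivWithinAt (fun s : ℝ ↦ (s, q.2)) ((1 : ℝ), (0 : ℝ)) univ q.1 :=
    ((hasDerivAt_id q.1).prodMk (hasDerivAt_const q.1 q.2)).hasDerivWithinAt
  have h2 := HasFDerivWithinAt.comp_hasDerivWithinAt (x := q.1) (f := fun s : ℝ ↦ (s, q.2))
    (l := f) (t := univ ×ˢ J) hf.hasFDerivWithinAt h1 (fun s _ ↦ ⟨mem_univ _, hq⟩)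
  simpa [Function.comp_def, hasDerivWithinAt_univ] using h2

theorem ds_eq_fderivWithin {J : Set ℝ} {f : ℝ × ℝ → X} {q : ℝ × ℝ}
    (hf : DifferentiableWithinAt ℝ f (univ ×ˢ J) q) (hq : q.2 ∈ J) :
    ds f q = fderivWithin ℝ f (univ ×ˢ J) q (1, 0) :=
  (hasDerivAt_slice_fst hf hq).deriv

theorem hasDerivAt_slice_snd {J : Set ℝ} {f : ℝ × ℝ → X} {q : ℝ × ℝ}
    (hf : DifferentiableWithinAt ℝ f (univ ×ˢ J) q) (hq : J ∈ 𝓝 q.2) :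
    HasDerivAt (fun t ↦ f (q.1, t)) (fderivWithin ℝ f (univ ×ˢ J) q (0, 1)) q.2 := by
  have h1 : HasDerivAt (fun t : ℝ ↦ (q.1, t)) ((0 : ℝ), (1 : ℝ)) q.2 :=
    (hasDerivAt_const q.2 q.1).prodMk (hasDerivAt_id q.2)
  have hS : (univ : Set ℝ) ×ˢ J ∈ 𝓝 q := prod_mem_nhds univ_mem hq
  have h2 := HasFDerivAt.comp_hasDerivAt (x := q.2) (f := fun t : ℝ ↦ (q.1, t))
    (l := f) (hf.hasFDerivWithinAt.hasFDerivAt hS) h1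
  simpa [Function.comp_def] using h2

theorem dt_eq_fderivWithin {J : Set ℝ} {f : ℝ × ℝ → X} {q : ℝ × ℝ}
    (hf : DifferentiableWithinAt ℝ f (univ ×ˢ J) q) (hq : J ∈ 𝓝 q.2) :
    dt f q = fderivWithin ℝ f (univ ×ˢ J) q (0, 1) :=
  (hasDerivAt_slice_snd hf hq).deriv

theorem eventually_differentiableWithinAt {S : Set (ℝ × ℝ)} {f : ℝ × ℝ → X} {q : ℝ × ℝ}
    (hf : ContDiffWithinAt ℝ ∞ f S q) (hq : q ∈ S) :
    ∀ᶠ r in 𝓝[S] q, DifferentiableWithinAt ℝ f S r := by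
  have h := (hf.of_le (m := 1) (by exact_mod_cast le_top)).eventually (by simp)
  rw [insert_eq_of_mem hq] at h
  filter_upwards [h] with r hr using hr.differentiableWithinAt one_ne_zero

/-- Near q within the strip, `ds f` is the within-derivative evaluated on (1, 0), so smoothness up
to the initial line is inherited. -/
theorem contDiffWithinAt_ds {J : Set ℝ} (hJ : UniqueDiffOn ℝ J) {f : ℝ × ℝ → X} {q : ℝ × ℝ}
    (hf : ContDiffWithinAt ℝ ∞ f (univ ×ˢ J) q) (hq : q.2 ∈ J) :
    ContDiffWithinAt ℝ ∞ (ds f) (univ ×ˢ J) q := by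
  have hqS : q ∈ (univ : Set ℝ) ×ˢ J := ⟨mem_univ _, hq⟩
  have h : ContDiffWithinAt ℝ ∞ (fun r ↦ fderivWithin ℝ f (univ ×ˢ J) r (1, 0)) (univ ×ˢ J) q :=
    (hf.fderivWithin_right (uniqueDiffOn_univ.prod hJ) (by simp) hqS).clm_apply
      contDiffWithinAt_const
  refine h.congr_of_eventuallyEq ?_ (ds_eq_fderivWithin ?_ hq)
  · filter_upwards [eventually_differentiableWithinAt hf hqS, self_mem_nhdsWithin] with r hr hrS
    exact ds_eq_fderivWithin hr hrS.2
  · exact hf.differentiableWithinAt (by simp)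

end SliceDerivatives

/-! ### The maximum principle on a cylinder. -/

section MaximumPrinciple

/-- A positive second derivative would make x a local minimum as well; f would then be constant near
x and its second derivative zero. -/
theorem _root_.IsLocalMax.deriv_deriv_nonpos {f : ℝ → ℝ} {x : ℝ} (h : IsLocalMax f x)
    (hc : ContinuousAt f x) : deriv (deriv f) x ≤ 0 := by
  by_contra! hpos
  have hmin := isLocalMin_of_deriv_deriv_pos hpos h.deriv_eq_zero hc
  have heq : f =ᶠ[𝓝 x] fun _ ↦ f x := by
    filter_upwards [h, hmin] with y h1 h2 using le_antisymm h1 h2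
  have := heq.deriv.deriv_eq
  simp only [deriv_const'] at this
  linarith

/-- Only earlier times are compared, because the maximum over a closed time interval may sit at its
right end. -/
theorem deriv_nonneg_of_forall_le_left {f : ℝ → ℝ} {a b : ℝ} (hab : a < b)
    (hf : DifferentiableAt ℝ f b) (h : ∀ t ∈ Icc a b, f t ≤ f b) : 0 ≤ deriv f b := by
  by_contra! hneg
  have h1 := hf.hasDerivAt.tendsto_slope
  have h2 : ∀ᶠ t in 𝓝[≠] b, slope f b t < 0 := h1.eventually_lt_const hneg
  have h3 : ∀ᶠ t in 𝓝[<] b, slope f b t < 0 :=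
    h2.filter_mono (nhdsWithin_mono _ fun t ht ↦ ne_of_lt ht)
  have h4 : ∀ᶠ t in 𝓝[<] b, t ∈ Ioo a b := Ioo_mem_nhdsLT hab
  obtain ⟨t, ht, hta, htb⟩ := (h3.and h4).exists
  have := h t ⟨hta.le, htb.le⟩
  rw [slope_def_field] at ht
  have : 0 ≤ (f t - f b) / (t - b) := div_nonneg_of_nonpos (by linarith) (by linarith)
  linarith

/-- The weak maximum principle for the heat operator on a cylinder. -/
theorem nonpos_of_heat_inequality {φ : ℝ × ℝ → ℝ} {P τ C : ℝ} (hP : 0 < P)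
    (hc : ContinuousOn φ (univ ×ˢ Icc 0 τ))
    (hper : ∀ s, ∀ t ∈ Icc 0 τ, φ (s + P, t) = φ (s, t)) (h0 : ∀ s, φ (s, 0) ≤ 0)
    (hdt : ∀ s, ∀ t ∈ Ioc 0 τ, DifferentiableAt ℝ (fun t' ↦ φ (s, t')) t)
    (hφ : ∀ s, ∀ t ∈ Ioc 0 τ, dt φ (s, t) ≤ ds (ds φ) (s, t) + C * φ (s, t)) :
    ∀ s, ∀ t ∈ Icc 0 τ, φ (s, t) ≤ 0 := by
  intro s₁ t₁ ht₁
  by_contra! hpos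
  -- The weight makes the contradiction strict: at a positive maximum of h one has φ_t ≥ (C + 1)φ
  -- and φ_ss ≤ 0, whereas the hypothesis gives φ_t ≤ φ_ss + Cφ.
  let h : ℝ × ℝ → ℝ := fun q ↦ Real.exp (-(C + 1) * q.2) * φ q
  have hhc : ContinuousOn h (univ ×ˢ Icc 0 τ) := by
    apply ContinuousOn.mul _ hc
    fun_prop
  have hcomp : IsCompact (Icc 0 P ×ˢ Icc 0 τ) := isCompact_Icc.prod isCompact_Icc
  obtain ⟨⟨s₀, t₀⟩, ⟨hs₀, ht₀⟩, hmax⟩ := hcomp.exists_isMaxOn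
    ⟨(0, t₁), ⟨le_rfl, hP.le⟩, ht₁⟩ (hhc.mono (prod_mono (subset_univ _) subset_rfl))
  have hglob : ∀ s, ∀ t ∈ Icc 0 τ, h (s, t) ≤ h (s₀, t₀) := by
    intro s t ht
    have hp : Function.Periodic (fun s ↦ h (s, t)) P := by
      intro s
      simp only [h, hper s t ht]
    obtain ⟨s', hs', he⟩ := hp.exists_mem_Ico₀ hP s
    rw [he]
    exact hmax (show (s', t) ∈ Icc 0 P ×ˢ Icc 0 τ from ⟨⟨hs'.1, hs'.2.le⟩, ht⟩)
  have hm : 0 < h (s₀, t₀) :=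
    lt_of_lt_of_le (mul_pos (Real.exp_pos _) hpos) (hglob s₁ t₁ ht₁)
  have hφ0 : 0 < φ (s₀, t₀) := pos_of_mul_pos_right hm (Real.exp_pos _).le
  have ht0 : 0 < t₀ := by
    rcases ht₀.1.lt_or_eq with h' | h'
    · exact h'
    · subst h'
      linarith [h0 s₀]
  have htI : t₀ ∈ Ioc 0 τ := ⟨ht0, ht₀.2⟩
  have hd : HasDerivAt (fun t ↦ h (s₀, t))
      (Real.exp (-(C + 1) * t₀) * (-(C + 1)) * φ (s₀, t₀)
        + Real.exp (-(C + 1) * t₀) * dt φ (s₀, t₀)) t₀ := by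
    have h1 : HasDerivAt (fun t ↦ Real.exp (-(C + 1) * t))
        (Real.exp (-(C + 1) * t₀) * (-(C + 1))) t₀ := by
      simpa using ((hasDerivAt_id t₀).const_mul (-(C + 1))).exp
    exact h1.mul (hdt s₀ t₀ htI).hasDerivAt
  have hd0 := deriv_nonneg_of_forall_le_left ht0 hd.differentiableAt
    fun t ht ↦ hglob s₀ t ⟨ht.1, ht.2.trans ht₀.2⟩
  rw [hd.deriv] at hd0
  have hdt1 : (C + 1) * φ (s₀, t₀) ≤ dt φ (s₀, t₀) := by
    have : 0 ≤ Real.exp (-(C + 1) * t₀) * (dt φ (s₀, t₀) - (C + 1) * φ (s₀, t₀)) := by linarith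
    linarith [nonneg_of_mul_nonneg_right this (Real.exp_pos _)]
  have hloc : IsLocalMax (fun s ↦ φ (s, t₀)) s₀ := by
    refine Eventually.of_forall fun s ↦ ?_
    exact le_of_mul_le_mul_left (hglob s t₀ ht₀) (Real.exp_pos _)
  have hcs : ContinuousAt (fun s ↦ φ (s, t₀)) s₀ := by
    have : Continuous (fun s ↦ φ (s, t₀)) :=
      hc.comp_continuous (by fun_prop) fun s ↦ ⟨mem_univ _, ht₀⟩
    exact this.continuousAt
  have hss : ds (ds φ) (s₀, t₀) ≤ 0 := hloc.deriv_deriv_nonpos hcs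
  nlinarith [hφ s₀ t₀ htI]

end MaximumPrinciple

/-! ### Vanishing from a bound on the heat operator. -/

section Uniqueness

variable {T : EReal}

theorem timeInterval_mem_nhds {t : ℝ} (ht : t ∈ timeInterval T) (h0 : 0 < t) :
    timeInterval T ∈ 𝓝 t := by
  have h1 : ∀ᶠ t' : ℝ in 𝓝 t, (t' : EReal) < T :=
    continuous_coe_real_ereal.continuousAt.eventually_lt continuousAt_const ht.2
  filter_upwards [h1, lt_mem_nhds h0] with t' h h' using ⟨h'.le, h⟩

theorem Icc_subset_timeInterval {t : ℝ} (ht : t ∈ timeInterval T) : Icc 0 t ⊆ timeInterval T :=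
  fun _ h ↦ ⟨h.1, lt_of_le_of_lt (EReal.coe_le_coe_iff.2 h.2) ht.2⟩

theorem uniqueDiffOn_timeInterval (hT : 0 < T) : UniqueDiffOn ℝ (timeInterval T) := by
  apply uniqueDiffOn_convex
  · refine OrdConnected.convex ⟨fun x hx y hy z hz ↦ ?_⟩
    exact Icc_subset_timeInterval hy ⟨hx.1.trans hz.1, hz.2⟩
  · obtain ⟨t, h0, h1⟩ := EReal.lt_iff_exists_real_btwn.1 hT
    have h0' : 0 < t := by exact_mod_cast h0
    exact ⟨t, mem_interior_iff_mem_nhds.2 (timeInterval_mem_nhds ⟨h0'.le, h1⟩ h0')⟩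

theorem hasDerivAt_norm_sq_and_deriv {G : Type*} [NormedAddCommGroup G] [InnerProductSpace ℝ G]
    {w : ℝ → G} {x : ℝ} (h : ∀ y, DifferentiableAt ℝ w y) (h' : DifferentiableAt ℝ (deriv w) x) :
    deriv (deriv fun y ↦ ‖w y‖ ^ 2) x =
      2 * ‖deriv w x‖ ^ 2 + 2 * inner ℝ (w x) (deriv (deriv w) x) := by
  have h1 : (deriv fun y ↦ ‖w y‖ ^ 2) = fun y ↦ 2 * inner ℝ (w y) (deriv w y) := by
    funext y
    exact (h y).hasDerivAt.norm_sq.deriv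
  rw [h1]
  have h2 := ((h x).hasDerivAt.inner ℝ h'.hasDerivAt).const_mul 2
  rw [h2.deriv, real_inner_self_eq_norm_sq]
  ring

/-- A map on a cylinder that vanishes at time `0` and whose image under the heat operator is
controlled by the map and its first spatial derivative vanishes identically. It is enough to have
this control near the points at which the map and its spatial derivative vanish. -/
theorem eq_zero_of_heat_operator_bound {G : Type*} [NormedAddCommGroup G] [InnerProductSpace ℝ G]
    (hT : 0 < T) {P : ℝ} (hP : 0 < P) {W : ℝ × ℝ → G}
    (hW : ContDiffOn ℝ ∞ W (univ ×ˢ timeInterval T))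
    (hper : ∀ s, ∀ t ∈ timeInterval T, W (s + P, t) = W (s, t)) (h0 : ∀ s, W (s, 0) = 0)
    (hloc : ∀ q : ℝ × ℝ, q.2 ∈ timeInterval T → W q = 0 → ds W q = 0 →
      ∃ C, ∀ᶠ r in 𝓝[univ ×ˢ timeInterval T] q, 0 < r.2 →
        ‖dt W r - ds (ds W) r‖ ≤ C * (‖W r‖ + ‖ds W r‖)) :
    ∀ s, ∀ t ∈ timeInterval T, W (s, t) = 0 := by
  set S : Set (ℝ × ℝ) := univ ×ˢ timeInterval T with hS
  have hJ := uniqueDiffOn_timeInterval hT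
  have hds : ContDiffOn ℝ ∞ (ds W) S := fun q hq ↦ contDiffWithinAt_ds hJ (hW q hq) hq.2
  have hdss : ContDiffOn ℝ ∞ (ds (ds W)) S := fun q hq ↦ contDiffWithinAt_ds hJ (hds q hq) hq.2
  have hWd : DifferentiableOn ℝ W S := hW.differentiableOn (by simp)
  have hsd : DifferentiableOn ℝ (ds W) S := hds.differentiableOn (by simp)
  -- At t = 0 the two-sided derivative `dt W` depends on values outside the strip. The
  -- within-derivative is continuous up to t = 0 and agrees with `dt W` for t > 0.
  have hdtc : ContinuousOn (fun r ↦ fderivWithin ℝ W S r (0, 1)) S :=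
    (hW.continuousOn_fderivWithin (uniqueDiffOn_univ.prod hJ) (by simp)).clm_apply
      continuousOn_const
  have hdt : ∀ r ∈ S, 0 < r.2 → dt W r = fderivWithin ℝ W S r (0, 1) := fun r hr h ↦
    dt_eq_fderivWithin (hWd r hr) (timeInterval_mem_nhds hr.2 h)
  have hloc' : ∀ q ∈ S, ∃ C, ∀ᶠ r in 𝓝[S] q, 0 < r.2 →
      ‖dt W r - ds (ds W) r‖ ≤ C * (‖W r‖ + ‖ds W r‖) := by
    intro q hq
    by_cases hz : W q = 0 ∧ ds W q = 0
    · exact hloc q hq.2 hz.1 hz.2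
    have hpos : 0 < ‖W q‖ + ‖ds W q‖ := by
      by_contra! hle
      refine hz ⟨norm_le_zero_iff.1 ?_, norm_le_zero_iff.1 ?_⟩ <;>
        linarith [norm_nonneg (W q), norm_nonneg (ds W q)]
    set m := ‖W q‖ + ‖ds W q‖ with hm
    set M := ‖fderivWithin ℝ W S q (0, 1) - ds (ds W) q‖ + 1 with hM
    have hMpos : 0 < M := by positivity
    have e1 : ∀ᶠ r in 𝓝[S] q, m / 2 < ‖W r‖ + ‖ds W r‖ :=
      ((hW.continuousOn q hq).norm.add (hds.continuousOn q hq).norm).eventually_const_lt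
        (show m / 2 < m by linarith)
    have e2 : ∀ᶠ r in 𝓝[S] q, ‖fderivWithin ℝ W S r (0, 1) - ds (ds W) r‖ < M :=
      ((hdtc q hq).sub (hdss.continuousOn q hq)).norm.eventually_lt_const (lt_add_one _)
    -- Near q the left side stays below M, while |W| + |W_s| stays above m / 2.
    refine ⟨2 * M / m, ?_⟩
    filter_upwards [e1, e2, self_mem_nhdsWithin] with r h1 h2 hrS hr
    rw [hdt r hrS hr]
    refine h2.le.trans ?_
    calc M = 2 * M / m * (m / 2) := by field_simp
      _ ≤ _ := by gcongr
  intro s₁ t₁ ht₁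
  have hsub := Icc_subset_timeInterval ht₁
  obtain ⟨C, hC⟩ : ∃ C, ∀ r ∈ Icc 0 P ×ˢ Icc 0 t₁, 0 < r.2 →
      ‖dt W r - ds (ds W) r‖ ≤ C * (‖W r‖ + ‖ds W r‖) := by
    have hK : IsCompact (Icc (0 : ℝ) P ×ˢ Icc (0 : ℝ) t₁) := isCompact_Icc.prod isCompact_Icc
    have hKS : Icc (0 : ℝ) P ×ˢ Icc (0 : ℝ) t₁ ⊆ S := prod_mono (subset_univ _) hsub
    refine hK.induction_on (p := fun K ↦ ∃ C, ∀ r ∈ K, 0 < r.2 →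
      ‖dt W r - ds (ds W) r‖ ≤ C * (‖W r‖ + ‖ds W r‖)) ⟨0, by simp⟩ ?_ ?_ ?_
    · rintro K K' hKK ⟨C, hC⟩
      exact ⟨C, fun r hr ↦ hC r (hKK hr)⟩
    · rintro K K' ⟨C, hC⟩ ⟨C', hC'⟩
      refine ⟨max C C', fun r hr h ↦ ?_⟩
      rcases hr with hr | hr
      · exact (hC r hr h).trans (by gcongr; exact le_max_left _ _)
      · exact (hC' r hr h).trans (by gcongr; exact le_max_right _ _)
    · intro q hq
      obtain ⟨C, hC⟩ := hloc' q (hKS hq)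
      exact ⟨_, nhdsWithin_mono q hKS hC, C, fun r hr ↦ hr⟩
  have hWper : ∀ t ∈ timeInterval T, (fun s ↦ W (s + P, t)) = fun s ↦ W (s, t) :=
    fun t ht ↦ funext fun s ↦ hper s t ht
  have hslice : ∀ t ∈ timeInterval T, ∀ s, DifferentiableAt ℝ (fun s' ↦ W (s', t)) s :=
    fun t ht s ↦ (hasDerivAt_slice_fst (q := (s, t)) (hWd _ ⟨mem_univ _, ht⟩)
      ht).differentiableAt
  have hslice' : ∀ t ∈ timeInterval T, ∀ s, DifferentiableAt ℝ (fun s' ↦ ds W (s', t)) s :=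
    fun t ht s ↦ (hasDerivAt_slice_fst (q := (s, t)) (hsd _ ⟨mem_univ _, ht⟩)
      ht).differentiableAt
  have hds_per : ∀ t ∈ timeInterval T, Function.Periodic (fun s ↦ ds W (s, t)) P := by
    intro t ht s
    simp only [ds]
    rw [← deriv_comp_add_const, hWper t ht]
  have hdss_per : ∀ t ∈ timeInterval T, Function.Periodic (fun s ↦ ds (ds W) (s, t)) P := by
    intro t ht s
    simp only [ds]
    rw [← deriv_comp_add_const]
    congr 1
    exact funext fun s ↦ hds_per t ht s
  have hbound : ∀ s, ∀ t ∈ Ioc 0 t₁,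
      ‖dt W (s, t) - ds (ds W) (s, t)‖ ≤ C * (‖W (s, t)‖ + ‖ds W (s, t)‖) := by
    intro s t ht
    have htT := hsub ⟨ht.1.le, ht.2⟩
    have hp : Function.Periodic
        (fun s ↦ (dt W (s, t), ds (ds W) (s, t), W (s, t), ds W (s, t))) P := by
      intro s
      have h1 : dt W (s + P, t) = dt W (s, t) := by
        simp only [dt]
        apply Filter.EventuallyEq.deriv_eq
        filter_upwards [timeInterval_mem_nhds htT ht.1] with t' ht' using hper s t' ht'
      have h2 := hdss_per t htT s
      have h3 := hds_per t htT s
      simp only at h2 h3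
      simp only [h1, h2, h3, hper s t htT]
    obtain ⟨s', hs', he⟩ := hp.exists_mem_Ico₀ hP s
    simp only [Prod.mk.injEq] at he
    rw [he.1, he.2.1, he.2.2.1, he.2.2.2]
    exact hC (s', t) ⟨⟨hs'.1, hs'.2.le⟩, ht.1.le, ht.2⟩ ht.1
  -- From (|W|²)_ss = 2|W_s|² + 2⟨W, W_ss⟩ and the bound, (|W|²)_t ≤ (|W|²)_ss - 2|W_s|² + 2C|W|² +
  -- 2C|W||W_s|. The last term is at most |W_s|² + C²|W|², which leaves the constant 2C + C².
  have hmain := nonpos_of_heat_inequality (φ := fun q ↦ ‖W q‖ ^ 2) (τ := t₁)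
    (C := 2 * C + C ^ 2) hP
    ((hW.continuousOn.mono (prod_mono subset_rfl hsub)).norm.pow 2)
    (fun s t ht ↦ by simp only [hper s t (hsub ht)]) (fun s ↦ by simp [h0])
    (fun s t ht ↦ by
      have htT := hsub ⟨ht.1.le, ht.2⟩
      exact (hasDerivAt_slice_snd (q := (s, t)) (hWd _ ⟨mem_univ _, htT⟩)
        (timeInterval_mem_nhds htT ht.1)).differentiableAt.norm_sq ℝ)
    (fun s t ht ↦ by
      have htT := hsub ⟨ht.1.le, ht.2⟩
      have e1 : dt (fun q ↦ ‖W q‖ ^ 2) (s, t) = 2 * inner ℝ (W (s, t)) (dt W (s, t)) :=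
        (hasDerivAt_slice_snd (q := (s, t)) (hWd _ ⟨mem_univ _, htT⟩)
          (timeInterval_mem_nhds htT ht.1)).differentiableAt.hasDerivAt.norm_sq.deriv
      have e2 : ds (ds (fun q ↦ ‖W q‖ ^ 2)) (s, t) = 2 * ‖ds W (s, t)‖ ^ 2
          + 2 * inner ℝ (W (s, t)) (ds (ds W) (s, t)) :=
        hasDerivAt_norm_sq_and_deriv (hslice t htT) (hslice' t htT s)
      rw [e1, e2]
      have e3 := real_inner_le_norm (W (s, t)) (dt W (s, t) - ds (ds W) (s, t))
      rw [inner_sub_right] at e3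
      have e4 := mul_le_mul_of_nonneg_left (hbound s t ht) (norm_nonneg (W (s, t)))
      nlinarith [sq_nonneg (‖ds W (s, t)‖ - C * ‖W (s, t)‖), sq_nonneg ‖ds W (s, t)‖])
    s₁ t₁ ⟨ht₁.1, le_rfl⟩
  exact norm_eq_zero.1 (pow_eq_zero_iff two_ne_zero |>.1 (le_antisymm hmain (sq_nonneg _)))

end Uniqueness

/-! ### Connections in coordinates and how they transform. -/

section LocalConnections

variable {E F : Type*} [NormedAddCommGroup E] [NormedSpace ℝ E]
  [NormedAddCommGroup F] [NormedSpace ℝ F]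

/-- The Koszul formula for the Christoffel symbols `Γ` of the metric `G` at the point `y`. -/
def IsKoszulAt (G : E → E →L[ℝ] E →L[ℝ] ℝ) (Γ : E → E →L[ℝ] E →L[ℝ] E) (y : E) : Prop :=
  ∀ v w u, 2 * G y (Γ y v w) u = fderiv ℝ G y v w u + fderiv ℝ G y w v u - fderiv ℝ G y u v w

/-- The transformation law of Christoffel symbols under the change of coordinates `Φ`. -/
def ChristoffelLaw (Γ₀ : E → E →L[ℝ] E →L[ℝ] E) (Γ₁ : F → F →L[ℝ] F →L[ℝ] F) (Φ : E → F)
    (y : E) : Prop :=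
  ∀ v w, fderiv ℝ Φ y (Γ₀ y v w) =
    fderiv ℝ (fderiv ℝ Φ) y v w + Γ₁ (Φ y) (fderiv ℝ Φ y v) (fderiv ℝ Φ y w)

/-- The curvature `R(u, v) w` of the connection with Christoffel symbols `Γ`. -/
def localCurvature (Γ : E → E →L[ℝ] E →L[ℝ] E) (y u v w : E) : E :=
  fderiv ℝ Γ y u v w - fderiv ℝ Γ y v u w + (Γ y u (Γ y v w) - Γ y v (Γ y u w))

/-- The covariant derivative of the field `v` along the curve `y` in local coordinates. -/
def localCovDeriv (Γ : E → E →L[ℝ] E →L[ℝ] E) (y v : ℝ → E) (τ : ℝ) : E :=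
  deriv v τ + Γ (y τ) (deriv y τ) (v τ)

theorem _root_.ContDiffAt.fderiv_infty {f : E → F} {y : E} (h : ContDiffAt ℝ ∞ f y) :
    ContDiffAt ℝ ∞ (fderiv ℝ f) y :=
  h.fderiv_right (by simp)

theorem _root_.ContDiffAt.fderiv_fderiv_comm {f : E → F} {y : E} (h : ContDiffAt ℝ ∞ f y)
    (v w : E) : fderiv ℝ (fderiv ℝ f) y v w = fderiv ℝ (fderiv ℝ f) y w v :=
  h.isSymmSndFDerivAt (by rw [minSmoothness_of_isRCLikeNormedField]; exact ENat.LEInfty.out) v w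

/-- The product rule with the derivative known only through its values, which is the form needed
when derivatives are identified by uniqueness. -/
theorem _root_.HasFDerivAt.clm_apply₂ {E' F' G' H' : Type*}
    [NormedAddCommGroup E'] [NormedSpace ℝ E'] [NormedAddCommGroup F'] [NormedSpace ℝ F']
    [NormedAddCommGroup G'] [NormedSpace ℝ G'] [NormedAddCommGroup H'] [NormedSpace ℝ H']
    {B : E' → F' →L[ℝ] G' →L[ℝ] H'} {B' : E' →L[ℝ] F' →L[ℝ] G' →L[ℝ] H'}
    {f : E' → F'} {f' : E' →L[ℝ] F'} {g : E' → G'} {g' : E' →L[ℝ] G'} {x : E'}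
    (hB : HasFDerivAt B B' x) (hf : HasFDerivAt f f' x) (hg : HasFDerivAt g g' x) :
    ∃ L : E' →L[ℝ] H', HasFDerivAt (fun z ↦ B z (f z) (g z)) L x ∧
      ∀ a, L a = B' a (f x) (g x) + B x (f' a) (g x) + B x (f x) (g' a) := by
  refine ⟨_, (hB.clm_apply hf).clm_apply hg, fun a ↦ ?_⟩
  simp
  abel

theorem hasFDerivAt_comp_of_differentiableAt {E' H : Type*} [NormedAddCommGroup E']
    [NormedSpace ℝ E'] [NormedAddCommGroup H] [NormedSpace ℝ H] {B : F → F →L[ℝ] H} {Φ : E' → F}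
    {x : E'}
    (hB : DifferentiableAt ℝ B (Φ x)) (hΦ : DifferentiableAt ℝ Φ x) :
    HasFDerivAt (fun z ↦ B (Φ z)) ((fderiv ℝ B (Φ x)).comp (fderiv ℝ Φ x)) x :=
  hB.hasFDerivAt.comp x hΦ.hasFDerivAt

theorem _root_.HasFDerivAt.comp_clm_apply₂ {E' F' : Type*}
    [NormedAddCommGroup E'] [NormedSpace ℝ E'] [NormedAddCommGroup F'] [NormedSpace ℝ F']
    {B : F → F →L[ℝ] F →L[ℝ] F'} {Φ : E' → F} {f g : E' → F} {x : E'}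
    (hB : DifferentiableAt ℝ B (Φ x)) (hΦ : DifferentiableAt ℝ Φ x)
    (hf : DifferentiableAt ℝ f x) (hg : DifferentiableAt ℝ g x) :
    ∃ L : E' →L[ℝ] F', HasFDerivAt (fun z ↦ B (Φ z) (f z) (g z)) L x ∧
      ∀ a, L a = fderiv ℝ B (Φ x) (fderiv ℝ Φ x a) (f x) (g x)
        + B (Φ x) (fderiv ℝ f x a) (g x) + B (Φ x) (f x) (fderiv ℝ g x a) := by
  exact (hasFDerivAt_comp_of_differentiableAt (H := F →L[ℝ] F') hB hΦ).clm_apply₂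
    hf.hasFDerivAt hg.hasFDerivAt

theorem fderiv_apply_const {f : E → E →L[ℝ] F} {y : E} (hf : DifferentiableAt ℝ f y) (a v : E) :
    fderiv ℝ (fun x ↦ f x v) y a = fderiv ℝ f y a v := by
  rw [fderiv_clm_apply hf (differentiableAt_const v)]
  simp

theorem hasFDerivAt_apply_const₂ {B : E → E →L[ℝ] E →L[ℝ] F} {y : E}
    (hB : DifferentiableAt ℝ B y) (v w : E) :
    ∃ L : E →L[ℝ] F, HasFDerivAt (fun x ↦ B x v w) L y ∧ ∀ a, L a = fderiv ℝ B y a v w := by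
  obtain ⟨L, hL, h⟩ := hB.hasFDerivAt.clm_apply₂ (hasFDerivAt_const v y) (hasFDerivAt_const w y)
  exact ⟨L, hL, fun a ↦ by simpa using h a⟩

theorem differentiableAt_fderiv_apply {Φ : E → F} {y : E} (hΦ : ContDiffAt ℝ ∞ Φ y) (v : E) :
    DifferentiableAt ℝ (fun x ↦ fderiv ℝ Φ x v) y :=
  (hΦ.fderiv_infty.differentiableAt (by simp)).clm_apply (differentiableAt_const v)

/-- Isometries intertwine Levi-Civita connections. -/
theorem christoffelLaw_of_isometry {G₀ : E → E →L[ℝ] E →L[ℝ] ℝ} {G₁ : F → F →L[ℝ] F →L[ℝ] ℝ}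
    {Γ₀ : E → E →L[ℝ] E →L[ℝ] E} {Γ₁ : F → F →L[ℝ] F →L[ℝ] F} {Φ : E → F} {y : E}
    (hΦ : ContDiffAt ℝ ∞ Φ y) (hsurj : Function.Surjective (fderiv ℝ Φ y))
    (hG₀ : DifferentiableAt ℝ G₀ y) (hG₁ : DifferentiableAt ℝ G₁ (Φ y))
    (hsymm : ∀ v w, G₁ (Φ y) v w = G₁ (Φ y) w v)
    (hnondeg : ∀ v, (∀ u, G₁ (Φ y) v u = 0) → v = 0)
    (hG : ∀ᶠ x in 𝓝 y, ∀ v w, G₀ x v w = G₁ (Φ x) (fderiv ℝ Φ x v) (fderiv ℝ Φ x w))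
    (h₀ : IsKoszulAt G₀ Γ₀ y) (h₁ : IsKoszulAt G₁ Γ₁ (Φ y)) : ChristoffelLaw Γ₀ Γ₁ Φ y := by
  have hd : ∀ a v w, fderiv ℝ G₀ y a v w =
      fderiv ℝ G₁ (Φ y) (fderiv ℝ Φ y a) (fderiv ℝ Φ y v) (fderiv ℝ Φ y w)
      + G₁ (Φ y) (fderiv ℝ (fderiv ℝ Φ) y a v) (fderiv ℝ Φ y w)
      + G₁ (Φ y) (fderiv ℝ Φ y v) (fderiv ℝ (fderiv ℝ Φ) y a w) := by
    intro a v w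
    obtain ⟨L₀, hL₀, e₀⟩ := hasFDerivAt_apply_const₂ hG₀ v w
    obtain ⟨L₁, hL₁, e₁⟩ := HasFDerivAt.comp_clm_apply₂ hG₁ (hΦ.differentiableAt (by simp))
      (differentiableAt_fderiv_apply hΦ v) (differentiableAt_fderiv_apply hΦ w)
    have heq : (fun x ↦ G₀ x v w) =ᶠ[𝓝 y]
        fun x ↦ G₁ (Φ x) (fderiv ℝ Φ x v) (fderiv ℝ Φ x w) := by
      filter_upwards [hG] with x hx using hx v w
    rw [← e₀, (hL₀.congr_of_eventuallyEq heq.symm).unique hL₁, e₁]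
    simp only [fderiv_apply_const (hΦ.fderiv_infty.differentiableAt (by simp))]
  intro v w
  rw [← sub_eq_zero]
  apply hnondeg
  intro u'
  obtain ⟨u, rfl⟩ := hsurj u'
  have k₀ := h₀ v w u
  have k₁ := h₁ (fderiv ℝ Φ y v) (fderiv ℝ Φ y w) (fderiv ℝ Φ y u)
  -- Since D²Φ and G₁ are symmetric, the Koszul combination of the six second-derivative terms
  -- collapses to 2 G₁(D²Φ(v, w), DΦ u). Surjectivity of DΦ makes DΦ u an arbitrary test vector.
  rw [hG.self_of_nhds, hd, hd, hd, hΦ.fderiv_fderiv_comm w v, hΦ.fderiv_fderiv_comm u v,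
    hΦ.fderiv_fderiv_comm u w, hsymm (fderiv ℝ (fderiv ℝ Φ) y v u)] at k₀
  simp only [map_sub, map_add, sub_apply, add_apply]
  linarith

/-- Differentiate the transformation law and antisymmetrise in u and v. The third derivative of Φ is
symmetric and drops out; the remaining second derivatives are eliminated by the law itself, and the
mixed terms cancel. -/
theorem localCurvature_of_christoffelLaw {Γ₀ : E → E →L[ℝ] E →L[ℝ] E}
    {Γ₁ : F → F →L[ℝ] F →L[ℝ] F} {Φ : E → F} {y : E} (hΦ : ContDiffAt ℝ ∞ Φ y)
    (h₀ : DifferentiableAt ℝ Γ₀ y) (h₁ : DifferentiableAt ℝ Γ₁ (Φ y))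
    (h : ∀ᶠ x in 𝓝 y, ChristoffelLaw Γ₀ Γ₁ Φ x) (u v w : E) :
    fderiv ℝ Φ y (localCurvature Γ₀ y u v w) =
      localCurvature Γ₁ (Φ y) (fderiv ℝ Φ y u) (fderiv ℝ Φ y v) (fderiv ℝ Φ y w) := by
  have hΦ' := hΦ.fderiv_infty
  have hΦd := hΦ'.differentiableAt (by simp)
  have hd : ∀ a v w, fderiv ℝ (fderiv ℝ Φ) y a (Γ₀ y v w) + fderiv ℝ Φ y (fderiv ℝ Γ₀ y a v w) =
      fderiv ℝ (fderiv ℝ (fderiv ℝ Φ)) y a v w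
      + (fderiv ℝ Γ₁ (Φ y) (fderiv ℝ Φ y a) (fderiv ℝ Φ y v) (fderiv ℝ Φ y w)
      + Γ₁ (Φ y) (fderiv ℝ (fderiv ℝ Φ) y a v) (fderiv ℝ Φ y w)
      + Γ₁ (Φ y) (fderiv ℝ Φ y v) (fderiv ℝ (fderiv ℝ Φ) y a w)) := by
    intro a v w
    obtain ⟨L₀, hL₀, e₀⟩ := hasFDerivAt_apply_const₂ h₀ v w
    obtain ⟨L₁, hL₁, e₁⟩ := HasFDerivAt.comp_clm_apply₂ h₁ (hΦ.differentiableAt (by simp))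
      (differentiableAt_fderiv_apply hΦ v) (differentiableAt_fderiv_apply hΦ w)
    obtain ⟨L₂, hL₂, e₂⟩ := hasFDerivAt_apply_const₂
      (hΦ'.fderiv_infty.differentiableAt (by simp)) v w
    have heq : (fun x ↦ fderiv ℝ Φ x (Γ₀ x v w)) =ᶠ[𝓝 y] fun x ↦
        fderiv ℝ (fderiv ℝ Φ) x v w + Γ₁ (Φ x) (fderiv ℝ Φ x v) (fderiv ℝ Φ x w) := by
      filter_upwards [h] with x hx using hx v w
    have key := ((hΦd.hasFDerivAt.clm_apply hL₀).congr_of_eventuallyEq heq.symm).unique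
      (hL₂.add hL₁)
    have := congrArg (fun L ↦ L a) key
    simp only [add_apply, ContinuousLinearMap.comp_apply,
      ContinuousLinearMap.flip_apply, e₀, e₁, e₂, fderiv_apply_const hΦd] at this
    rw [← this, add_comm]
  have d1 := hd u v w
  have d2 := hd v u w
  have l1 : ∀ v w, fderiv ℝ (fderiv ℝ Φ) y v w =
      fderiv ℝ Φ y (Γ₀ y v w) - Γ₁ (Φ y) (fderiv ℝ Φ y v) (fderiv ℝ Φ y w) :=
    fun v w ↦ by rw [h.self_of_nhds v w]; abel
  rw [hΦ.fderiv_fderiv_comm v u, hΦ'.fderiv_fderiv_comm v u] at d2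
  simp only [localCurvature, map_add, map_sub]
  rw [eq_sub_of_add_eq' d1, eq_sub_of_add_eq' d2, l1 u (Γ₀ y v w), l1 v (Γ₀ y u w), l1 u w, l1 v w]
  simp only [map_sub]
  abel

/-- Differentiating DΦ(y)v along the curve produces the extra term D²Φ(y', v), which is exactly the
inhomogeneous term of the transformation law. -/
theorem localCovDeriv_of_christoffelLaw {Γ₀ : E → E →L[ℝ] E →L[ℝ] E}
    {Γ₁ : F → F →L[ℝ] F →L[ℝ] F} {Φ : E → F} {y v : ℝ → E} {y₁ v₁ : ℝ → F} {τ : ℝ}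
    (hΦ : ContDiffAt ℝ ∞ Φ (y τ)) (h : ChristoffelLaw Γ₀ Γ₁ Φ (y τ))
    (hy : DifferentiableAt ℝ y τ) (hv : DifferentiableAt ℝ v τ)
    (hy₁ : y₁ =ᶠ[𝓝 τ] fun x ↦ Φ (y x)) (hv₁ : v₁ =ᶠ[𝓝 τ] fun x ↦ fderiv ℝ Φ (y x) (v x)) :
    localCovDeriv Γ₁ y₁ v₁ τ = fderiv ℝ Φ (y τ) (localCovDeriv Γ₀ y v τ) := by
  have e1 : deriv y₁ τ = fderiv ℝ Φ (y τ) (deriv y τ) := by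
    rw [hy₁.deriv_eq]
    exact ((hΦ.differentiableAt (by simp)).hasFDerivAt.comp_hasDerivAt τ hy.hasDerivAt).deriv
  have e2 : deriv v₁ τ =
      fderiv ℝ (fderiv ℝ Φ) (y τ) (deriv y τ) (v τ) + fderiv ℝ Φ (y τ) (deriv v τ) := by
    rw [hv₁.deriv_eq]
    exact (((hΦ.fderiv_infty.differentiableAt (by simp)).hasFDerivAt.comp_hasDerivAt τ
      hy.hasDerivAt).clm_apply hv.hasDerivAt).deriv
  have l := h (deriv y τ) (v τ)
  simp only [localCovDeriv, e1, e2, hy₁.eq_of_nhds, hv₁.eq_of_nhds, map_add, l]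
  abel

end LocalConnections

/-! ### Components of tangent vectors and changes of chart. -/

section Charts

variable {n : ℕ} {N : Type*} [TopologicalSpace N] [ChartedSpace (EuclideanSpace ℝ (Fin n)) N]
  [IsManifold (𝓡 n) ∞ N]

/-- The change of coordinates from the chart around `x₀` to the chart around `x₁`. -/
def transition (x₀ x₁ : N) (y : EuclideanSpace ℝ (Fin n)) : EuclideanSpace ℝ (Fin n) :=
  extChartAt (𝓡 n) x₁ ((extChartAt (𝓡 n) x₀).symm y)

theorem contDiffAt_transition {x₀ x₁ p : N} (h₀ : p ∈ (extChartAt (𝓡 n) x₀).source)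
    (h₁ : p ∈ (extChartAt (𝓡 n) x₁).source) :
    ContDiffAt ℝ ∞ (transition x₀ x₁) (extChartAt (𝓡 n) x₀ p) := by
  have h : extChartAt (𝓡 n) x₀ p ∈
      ((extChartAt (𝓡 n) x₀).symm ≫ extChartAt (𝓡 n) x₁).source := by
    rw [PartialEquiv.trans_source'', PartialEquiv.symm_symm, PartialEquiv.symm_target]
    exact mem_image_of_mem _ ⟨h₀, h₁⟩
  have := contDiffWithinAt_ext_coord_change (I := 𝓡 n) (n := ∞) x₁ x₀ h
  rwa [ModelWithCorners.range_eq_univ, contDiffWithinAt_univ] at this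

theorem transition_extChartAt {x₀ x₁ p : N} (h₀ : p ∈ (extChartAt (𝓡 n) x₀).source) :
    transition x₀ x₁ (extChartAt (𝓡 n) x₀ p) = extChartAt (𝓡 n) x₁ p := by
  rw [transition, (extChartAt (𝓡 n) x₀).left_inv h₀]

theorem toCoord_ofCoord {x₀ p : N} (h₀ : p ∈ (extChartAt (𝓡 n) x₀).source)
    (w : EuclideanSpace ℝ (Fin n)) : toCoord x₀ p (ofCoord x₀ p w) = w := by
  rw [extChartAt_source] at h₀
  exact Trivialization.continuousLinearMapAt_symmL _ (by simpa using h₀) w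

theorem ofCoord_toCoord {x₀ p : N} (h₀ : p ∈ (extChartAt (𝓡 n) x₀).source)
    (v : TangentSpace (𝓡 n) p) : ofCoord x₀ p (toCoord x₀ p v) = v := by
  rw [extChartAt_source] at h₀
  exact Trivialization.symmL_continuousLinearMapAt _ (by simpa using h₀) v

/-- The cocycle identity removes the chart at p, through which the tangent space at p is modelled,
and leaves the Jacobian of the transition map. -/
theorem toCoord_ofCoord_eq_fderiv {x₀ x₁ p : N} (h₀ : p ∈ (extChartAt (𝓡 n) x₀).source)
    (h₁ : p ∈ (extChartAt (𝓡 n) x₁).source) (w : EuclideanSpace ℝ (Fin n)) :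
    toCoord x₁ p (ofCoord x₀ p w) =
      fderiv ℝ (transition x₀ x₁) (extChartAt (𝓡 n) x₀ p) w := by
  have h₀' := h₀
  have h₁' := h₁
  rw [extChartAt_source] at h₀' h₁'
  unfold toCoord ofCoord
  rw [TangentBundle.continuousLinearMapAt_trivializationAt_eq_core h₁',
    TangentBundle.symmL_trivializationAt_eq_core h₀']
  have h2 := tangentCoordChange_comp (I := 𝓡 n) (w := x₀) (x := p) (y := x₁) (z := p) (v := w)
    ⟨⟨h₀, mem_extChartAt_source p⟩, h₁⟩
  refine h2.trans ?_
  have h3 := hasFDerivWithinAt_tangentCoordChange (I := 𝓡 n) (x := x₀) (y := x₁) (z := p) ⟨h₀, h₁⟩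
  rw [ModelWithCorners.range_eq_univ, hasFDerivWithinAt_univ] at h3
  rw [← h3.fderiv]
  rfl

theorem toCoord_eq_fderiv_toCoord {x₀ x₁ p : N} (h₀ : p ∈ (extChartAt (𝓡 n) x₀).source)
    (h₁ : p ∈ (extChartAt (𝓡 n) x₁).source) (v : TangentSpace (𝓡 n) p) :
    toCoord x₁ p v = fderiv ℝ (transition x₀ x₁) (extChartAt (𝓡 n) x₀ p) (toCoord x₀ p v) := by
  rw [← toCoord_ofCoord_eq_fderiv h₀ h₁, ofCoord_toCoord h₀]

theorem eventually_symm_mem {x₀ p : N} {U : Set N} (h : p ∈ (extChartAt (𝓡 n) x₀).source)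
    (hU : U ∈ 𝓝 p) :
    ∀ᶠ y in 𝓝 (extChartAt (𝓡 n) x₀ p), (extChartAt (𝓡 n) x₀).symm y ∈ U :=
  (continuousAt_extChartAt_symm' h).eventually_mem (by
    rwa [(extChartAt (𝓡 n) x₀).left_inv h])

theorem eventually_mem_target {x₀ p : N} (h : p ∈ (extChartAt (𝓡 n) x₀).source) :
    ∀ᶠ y in 𝓝 (extChartAt (𝓡 n) x₀ p), y ∈ (extChartAt (𝓡 n) x₀).target :=
  (isOpen_extChartAt_target x₀).mem_nhds ((extChartAt (𝓡 n) x₀).map_source h)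

theorem surjective_fderiv_transition {x₀ x₁ p : N} (h₀ : p ∈ (extChartAt (𝓡 n) x₀).source)
    (h₁ : p ∈ (extChartAt (𝓡 n) x₁).source) :
    Function.Surjective (fderiv ℝ (transition x₀ x₁) (extChartAt (𝓡 n) x₀ p)) := fun w ↦
  ⟨toCoord x₀ p (ofCoord x₁ p w), by
    rw [← toCoord_eq_fderiv_toCoord h₀ h₁, toCoord_ofCoord h₁]⟩

theorem toCoord_add (x₀ p : N) (v w : TangentSpace (𝓡 n) p) :
    toCoord x₀ p (v + w) = toCoord x₀ p v + toCoord x₀ p w := map_add _ _ _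

theorem toCoord_sub (x₀ p : N) (v w : TangentSpace (𝓡 n) p) :
    toCoord x₀ p (v - w) = toCoord x₀ p v - toCoord x₀ p w := map_sub _ _ _

theorem toCoord_neg (x₀ p : N) (v : TangentSpace (𝓡 n) p) :
    toCoord x₀ p (-v) = -toCoord x₀ p v := map_neg _ _

theorem toCoord_smul (x₀ p : N) (c : ℝ) (v : TangentSpace (𝓡 n) p) :
    toCoord x₀ p (c • v) = c • toCoord x₀ p v := map_smul _ _ _

theorem ofCoord_add (x₀ p : N) (v w : EuclideanSpace ℝ (Fin n)) :
    ofCoord x₀ p (v + w) = ofCoord x₀ p v + ofCoord x₀ p w := map_add _ _ _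

theorem ofCoord_smul (x₀ p : N) (c : ℝ) (v : EuclideanSpace ℝ (Fin n)) :
    ofCoord x₀ p (c • v) = c • ofCoord x₀ p v := map_smul _ _ _

/-- Vector fields with constant components are smooth; applied to the coordinate frame this gives
smooth metric coefficients. -/
theorem contMDiffOn_ofCoord (x₀ : N) (w : EuclideanSpace ℝ (Fin n)) :
    ContMDiffOn 𝓘(ℝ, EuclideanSpace ℝ (Fin n)) (𝓡 n).tangent ∞
      (fun y ↦ (⟨(extChartAt (𝓡 n) x₀).symm y, ofCoord x₀ ((extChartAt (𝓡 n) x₀).symm y) w⟩ :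
        TangentBundle (𝓡 n) N)) (extChartAt (𝓡 n) x₀).target := by
  set e := trivializationAt (EuclideanSpace ℝ (Fin n)) (TangentSpace (𝓡 n) : N → Type _) x₀
  have hs : ∀ y ∈ (extChartAt (𝓡 n) x₀).target,
      (extChartAt (𝓡 n) x₀).symm y ∈ e.baseSet := by
    intro y hy
    have := (extChartAt (𝓡 n) x₀).map_target hy
    rw [extChartAt_source] at this
    exact this
  refine (e.contMDiffOn_iff fun y hy ↦ ?_).2 ⟨contMDiffOn_extChartAt_symm x₀, ?_⟩
  · exact e.mem_source.2 (hs y hy)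
  · refine (contMDiffOn_const (c := w)).congr fun y hy ↦ ?_
    have h1 := toCoord_ofCoord ((extChartAt (𝓡 n) x₀).map_target hy) w
    unfold toCoord at h1
    rw [Trivialization.continuousLinearMapAt_apply_of_mem ℝ e (hs y hy)] at h1
    exact h1

/-- Components of a smooth vector field along a map are smooth. -/
theorem contDiffWithinAt_toCoord {X : Type*} [NormedAddCommGroup X] [NormedSpace ℝ X]
    {f : X → N} {V : ∀ x, TangentSpace (𝓡 n) (f x)} {S : Set X} {x : X} {x₀ : N}
    (hV : ContMDiffWithinAt 𝓘(ℝ, X) (𝓡 n).tangent ∞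
      (fun x ↦ (⟨f x, V x⟩ : TangentBundle (𝓡 n) N)) S x)
    (hx : f x ∈ (extChartAt (𝓡 n) x₀).source) :
    ContDiffWithinAt ℝ ∞ (fun x ↦ toCoord x₀ (f x) (V x)) S x := by
  set e := trivializationAt (EuclideanSpace ℝ (Fin n)) (TangentSpace (𝓡 n) : N → Type _) x₀
  have hx' : f x ∈ (chartAt (EuclideanSpace ℝ (Fin n)) x₀).source := by
    rwa [extChartAt_source] at hx
  have h := (e.contMDiffWithinAt_iff (f := fun x ↦ (⟨f x, V x⟩ : TangentBundle (𝓡 n) N))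
    (e.mem_source.2 hx')).1 hV
  refine (h.2.contDiffWithinAt).congr_of_eventuallyEq ?_ ?_
  · have : ∀ᶠ z in 𝓝[S] x, f z ∈ e.baseSet :=
      h.1.continuousWithinAt.eventually_mem (e.open_baseSet.mem_nhds hx')
    filter_upwards [this] with z hz
    exact e.continuousLinearMapAt_apply_of_mem ℝ hz (V z)
  · exact e.continuousLinearMapAt_apply_of_mem ℝ hx' (V x)

theorem contDiffWithinAt_extChartAt_comp {X : Type*} [NormedAddCommGroup X] [NormedSpace ℝ X]
    {f : X → N} {S : Set X} {x : X} {x₀ : N} (hf : ContMDiffWithinAt 𝓘(ℝ, X) (𝓡 n) ∞ f S x)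
    (hx : f x ∈ (extChartAt (𝓡 n) x₀).source) :
    ContDiffWithinAt ℝ ∞ (fun x ↦ extChartAt (𝓡 n) x₀ (f x)) S x := by
  rw [extChartAt_source] at hx
  exact (ContMDiffAt.comp_contMDiffWithinAt x (contMDiffAt_extChartAt' hx) hf).contDiffWithinAt

theorem toCoord_velocity {c : ℝ → N} {τ : ℝ} {x₀ : N}
    (hc : MDifferentiableAt 𝓘(ℝ, ℝ) (𝓡 n) c τ) (h : c τ ∈ (extChartAt (𝓡 n) x₀).source) :
    toCoord x₀ (c τ) (velocity c τ) = deriv (fun x ↦ extChartAt (𝓡 n) x₀ (c x)) τ := by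
  rw [extChartAt_source] at h
  rw [toCoord_eq_mfderiv _ _ h, velocity]
  have h1 : MDifferentiableAt (𝓡 n) 𝓘(ℝ, EuclideanSpace ℝ (Fin n)) (extChartAt (𝓡 n) x₀) (c τ) :=
    mdifferentiableAt_extChartAt h
  have h2 := mfderiv_comp τ h1 hc
  have h3 : mfderiv 𝓘(ℝ, ℝ) 𝓘(ℝ, EuclideanSpace ℝ (Fin n)) (extChartAt (𝓡 n) x₀ ∘ c) τ (1 : ℝ)
      = deriv (fun x ↦ extChartAt (𝓡 n) x₀ (c x)) τ := by
    rw [mfderiv_eq_fderiv]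
    exact fderiv_apply_one_eq_deriv
  rw [← h3, h2]
  rfl

end Charts

/-! ### Smoothness of the inverse matrix. -/

section MatrixSmoothness

variable {X ι : Type*} [NormedAddCommGroup X] [NormedSpace ℝ X] [Fintype ι] [DecidableEq ι]

theorem contDiffAt_det {M : X → Matrix ι ι ℝ} {x : X} {m : ℕ∞ω}
    (h : ∀ i j, ContDiffAt ℝ m (fun z ↦ M z i j) x) : ContDiffAt ℝ m (fun z ↦ (M z).det) x := by
  simp only [Matrix.det_apply]
  refine ContDiffAt.sum fun σ _ ↦ ContDiffAt.const_smul _ ?_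
  exact contDiffAt_prod fun i _ ↦ h _ _

/-- Cramer's rule: an entry of the inverse is the quotient by det M of the determinant of M with one
row replaced by a constant one. -/
theorem contDiffAt_matrix_inv {M : X → Matrix ι ι ℝ} {x : X} {m : ℕ∞ω}
    (h : ∀ i j, ContDiffAt ℝ m (fun z ↦ M z i j) x) (hx : (M x).det ≠ 0) (i j : ι) :
    ContDiffAt ℝ m (fun z ↦ (M z)⁻¹ i j) x := by
  simp only [Matrix.inv_def, Ring.inverse_eq_inv', Matrix.smul_apply, smul_eq_mul,
    Matrix.adjugate_apply]
  refine ((contDiffAt_det h).inv hx).mul (contDiffAt_det fun k l ↦ ?_)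
  by_cases hk : k = j
  · subst hk
    simpa using contDiffAt_const
  · simpa [hk] using h k l

end MatrixSmoothness

/-! ### Reduction to a basis and an index identity. -/

section Helpers

variable {X H E ι : Type*} [NormedAddCommGroup X] [NormedSpace ℝ X] [NormedAddCommGroup H]
  [NormedSpace ℝ H] [NormedAddCommGroup E] [NormedSpace ℝ E]

theorem _root_.ContDiffAt.smul_const_right {f : X → ℝ} {x : X} {m : ℕ∞ω} (hf : ContDiffAt ℝ m f x)
    (L : E →L[ℝ] H) : ContDiffAt ℝ m (fun z ↦ f z • L) x :=
  hf.smul contDiffAt_const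

theorem eq_of_eq_basis {f g : E → H} (b : Module.Basis ι ℝ E) (hf : IsLinearMap ℝ f)
    (hg : IsLinearMap ℝ g) (h : ∀ i, f (b i) = g (b i)) (v : E) : f v = g v :=
  LinearMap.congr_fun (b.ext (f₁ := hf.mk' f) (f₂ := hg.mk' g) h) v

theorem isKoszulAt_of_basis (b : Module.Basis ι ℝ E) {G : E → E →L[ℝ] E →L[ℝ] ℝ}
    {Γ : E → E →L[ℝ] E →L[ℝ] E} {y : E} (h : ∀ i j r, 2 * G y (Γ y (b i) (b j)) (b r) =
      fderiv ℝ G y (b i) (b j) (b r) + fderiv ℝ G y (b j) (b i) (b r)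
        - fderiv ℝ G y (b r) (b i) (b j)) : IsKoszulAt G Γ y := by
  have h1 : ∀ a b w u, fderiv ℝ G y (a + b) w u = fderiv ℝ G y a w u + fderiv ℝ G y b w u :=
    fun a b w u ↦ by rw [ContinuousLinearMap.map_add]; rfl
  have h2 : ∀ (c : ℝ) a w u, fderiv ℝ G y (c • a) w u = c * fderiv ℝ G y a w u :=
    fun c a w u ↦ by rw [ContinuousLinearMap.map_smul]; rfl
  intro v w u
  generalize hT : fderiv ℝ G y = T at *
  refine eq_of_eq_basis b (f := fun v ↦ 2 * G y (Γ y v w) u)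
    (g := fun v ↦ T v w u + T w v u - T u v w)
    ⟨fun a b ↦ by simp; ring, fun c a ↦ by simp; ring⟩
    ⟨fun a b ↦ by rw [h1]; simp; ring, fun c a ↦ by rw [h2]; simp; ring⟩ (fun i ↦ ?_) v
  refine eq_of_eq_basis b (f := fun w ↦ 2 * G y (Γ y (b i) w) u)
    (g := fun w ↦ T (b i) w u + T w (b i) u - T u (b i) w)
    ⟨fun a b ↦ by simp; ring, fun c a ↦ by simp; ring⟩
    ⟨fun a b ↦ by rw [h1]; simp; ring, fun c a ↦ by rw [h2]; simp; ring⟩ (fun j ↦ ?_) w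
  exact eq_of_eq_basis b (f := fun u ↦ 2 * G y (Γ y (b i) (b j)) u)
    (g := fun u ↦ T (b i) (b j) u + T (b j) (b i) u - T u (b i) (b j))
    ⟨fun a b ↦ by simp; ring, fun c a ↦ by simp; ring⟩
    ⟨fun a b ↦ by rw [h1]; simp; ring, fun c a ↦ by rw [h2]; simp; ring⟩ (fun r ↦ h i j r) u

/-- With D = ∂Γᵐ, A = Γᵐ and B = Γʳ, the left side is the m-th component of the curvature written
with bilinear maps, and the right side is the classical index formula. -/
theorem sum_curvature_identity {κ : Type*} [Fintype κ] (D : κ → κ → κ → ℝ) (A : κ → κ → ℝ)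
    (B : κ → κ → κ → ℝ) (u v w : κ → ℝ) :
    (∑ j, ∑ l, (∑ i, u i * D i j l) * (v j * w l)) - (∑ j, ∑ l, (∑ i, v i * D i j l) * (u j * w l))
      + ((∑ i, ∑ r, A i r * (u i * ∑ j, ∑ l, B r j l * (v j * w l)))
        - ∑ i, ∑ r, A i r * (v i * ∑ j, ∑ l, B r j l * (u j * w l))) =
    ∑ l, ∑ i, ∑ j, (D i j l - D j i l + ∑ r, (A i r * B r j l - A j r * B r i l))
      * u i * v j * w l := by
  have h1 : ∀ u v : κ → ℝ, ∑ j, ∑ l, (∑ i, u i * D i j l) * (v j * w l) =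
      ∑ l, ∑ i, ∑ j, D i j l * u i * v j * w l := by
    intro u v
    rw [Finset.sum_comm]
    refine Finset.sum_congr rfl fun l _ ↦ ?_
    simp only [Finset.sum_mul]
    rw [Finset.sum_comm]
    exact Finset.sum_congr rfl fun i _ ↦ Finset.sum_congr rfl fun j _ ↦ by ring
  have h2 : ∀ u v : κ → ℝ, ∑ i, ∑ r, A i r * (u i * ∑ j, ∑ l, B r j l * (v j * w l)) =
      ∑ l, ∑ i, ∑ j, (∑ r, A i r * B r j l) * u i * v j * w l := by
    intro u v
    rw [Finset.sum_comm (s := Finset.univ) (t := Finset.univ)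
      (f := fun l i ↦ ∑ j, (∑ r, A i r * B r j l) * u i * v j * w l)]
    refine Finset.sum_congr rfl fun i _ ↦ ?_
    simp only [Finset.sum_mul, Finset.mul_sum]
    rw [Finset.sum_comm, Finset.sum_comm (s := Finset.univ) (t := Finset.univ)
      (f := fun l j ↦ ∑ r, A i r * B r j l * u i * v j * w l)]
    refine Finset.sum_congr rfl fun j _ ↦ ?_
    rw [Finset.sum_comm]
    exact Finset.sum_congr rfl fun i _ ↦ Finset.sum_congr rfl fun j _ ↦ by ring
  rw [h1, h1, h2, h2, ← Finset.sum_sub_distrib, ← Finset.sum_sub_distrib, ← Finset.sum_add_distrib]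
  refine Finset.sum_congr rfl fun l _ ↦ ?_
  rw [Finset.sum_comm (f := fun i j ↦ D i j l * v i * u j * w l),
    Finset.sum_comm (f := fun i j ↦ (∑ r, A i r * B r j l) * v i * u j * w l)]
  simp only [← Finset.sum_sub_distrib, ← Finset.sum_add_distrib]
  refine Finset.sum_congr rfl fun i _ ↦ Finset.sum_congr rfl fun j _ ↦ ?_
  rw [Finset.sum_sub_distrib]
  ring

end Helpers

/-! ### Metric, Christoffel symbols and curvature in an arbitrary chart. -/

section Metric

variable {n : ℕ} {N : Type*} [TopologicalSpace N] [ChartedSpace (EuclideanSpace ℝ (Fin n)) N]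
  [IsManifold (𝓡 n) ∞ N] [RiemannianBundle (fun x : N ↦ TangentSpace (𝓡 n) x)]

theorem eq_of_eq_single {F : Type*} [NormedAddCommGroup F] [NormedSpace ℝ F]
    {f g : EuclideanSpace ℝ (Fin n) → F} (hf : IsLinearMap ℝ f) (hg : IsLinearMap ℝ g)
    (h : ∀ i, f (EuclideanSpace.single i 1) = g (EuclideanSpace.single i 1))
    (v : EuclideanSpace ℝ (Fin n)) : f v = g v :=
  eq_of_eq_basis (EuclideanSpace.basisFun (Fin n) ℝ).toBasis hf hg (fun i ↦ by simpa using h i) v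

/-- The Riemannian metric in the chart around `x₀`. -/
def gram (x₀ : N) (y : EuclideanSpace ℝ (Fin n)) :
    EuclideanSpace ℝ (Fin n) →L[ℝ] EuclideanSpace ℝ (Fin n) →L[ℝ] ℝ :=
  ∑ i, ∑ j, metricCoeff x₀ y i j •
    (EuclideanSpace.proj i : EuclideanSpace ℝ (Fin n) →L[ℝ] ℝ).smulRight
    (EuclideanSpace.proj j : EuclideanSpace ℝ (Fin n) →L[ℝ] ℝ)

/-- The Christoffel symbols in the chart around `x₀`, as a bilinear map. -/
def christoffelMap (x₀ : N) (y : EuclideanSpace ℝ (Fin n)) :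
    EuclideanSpace ℝ (Fin n) →L[ℝ] EuclideanSpace ℝ (Fin n) →L[ℝ] EuclideanSpace ℝ (Fin n) :=
  ∑ k, ∑ i, ∑ j, christoffel x₀ k i j y •
    (EuclideanSpace.proj i : EuclideanSpace ℝ (Fin n) →L[ℝ] ℝ).smulRight
      ((EuclideanSpace.proj j : EuclideanSpace ℝ (Fin n) →L[ℝ] ℝ).smulRight
        (EuclideanSpace.single k (1 : ℝ)))

theorem gram_apply (x₀ : N) (y v w : EuclideanSpace ℝ (Fin n)) :
    gram x₀ y v w = ∑ i, ∑ j, metricCoeff x₀ y i j * (v i * w j) := by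
  simp [gram]

theorem christoffelMap_apply (x₀ : N) (y v w : EuclideanSpace ℝ (Fin n)) (k : Fin n) :
    christoffelMap x₀ y v w k = ∑ i, ∑ j, christoffel x₀ k i j y * (v i * w j) := by
  simp [christoffelMap, Finset.sum_apply, Pi.single_apply]

theorem gram_single (x₀ : N) (y : EuclideanSpace ℝ (Fin n)) (i j : Fin n) :
    gram x₀ y (EuclideanSpace.single i 1) (EuclideanSpace.single j 1) = metricCoeff x₀ y i j := by
  simp [gram_apply]

/-- Both sides are bilinear and agree on the standard basis. No condition on y is needed, as
`ofCoord` is linear at every base point. -/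
theorem gram_eq_inner (x₀ : N) (y v w : EuclideanSpace ℝ (Fin n)) :
    gram x₀ y v w = inner ℝ (ofCoord x₀ ((extChartAt (𝓡 n) x₀).symm y) v)
      (ofCoord x₀ ((extChartAt (𝓡 n) x₀).symm y) w) := by
  refine eq_of_eq_single (f := fun v ↦ gram x₀ y v w) (g := fun v ↦ inner ℝ
    (ofCoord x₀ ((extChartAt (𝓡 n) x₀).symm y) v) (ofCoord x₀ ((extChartAt (𝓡 n) x₀).symm y) w))
    ⟨by simp, by simp⟩
    ⟨fun a b ↦ by rw [ofCoord_add, inner_add_left], fun c a ↦ by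
      rw [ofCoord_smul, real_inner_smul_left, smul_eq_mul]⟩ (fun i ↦ ?_) v
  refine eq_of_eq_single (f := fun w ↦ gram x₀ y (EuclideanSpace.single i 1) w) (g := fun w ↦
    inner ℝ (ofCoord x₀ ((extChartAt (𝓡 n) x₀).symm y) (EuclideanSpace.single i 1))
      (ofCoord x₀ ((extChartAt (𝓡 n) x₀).symm y) w)) ⟨by simp, by simp⟩
    ⟨fun a b ↦ by rw [ofCoord_add, inner_add_right], fun c a ↦ by
      rw [ofCoord_smul, real_inner_smul_right, smul_eq_mul]⟩ (fun j ↦ ?_) w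
  exact gram_single x₀ y i j

theorem gram_toCoord {x₀ p : N} (h : p ∈ (extChartAt (𝓡 n) x₀).source)
    (v w : TangentSpace (𝓡 n) p) :
    gram x₀ (extChartAt (𝓡 n) x₀ p) (toCoord x₀ p v) (toCoord x₀ p w) = inner ℝ v w := by
  rw [gram_eq_inner]
  -- The base point recovered from the coordinates equals p only propositionally, and the fibre
  -- depends on it; hence the generalisation over q.
  have key : ∀ q, q = p → inner ℝ (ofCoord x₀ q (toCoord x₀ p v)) (ofCoord x₀ q (toCoord x₀ p w))
      = inner ℝ v w := by
    rintro q rfl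
    rw [ofCoord_toCoord h, ofCoord_toCoord h]
  exact key _ ((extChartAt (𝓡 n) x₀).left_inv h)

theorem gram_comm (x₀ : N) (y v w : EuclideanSpace ℝ (Fin n)) : gram x₀ y v w = gram x₀ y w v := by
  rw [gram_eq_inner, gram_eq_inner, real_inner_comm]

theorem metricCoeff_comm (x₀ : N) (y : EuclideanSpace ℝ (Fin n)) (i j : Fin n) :
    metricCoeff x₀ y i j = metricCoeff x₀ y j i := by
  rw [← gram_single, gram_comm, gram_single]

theorem eq_zero_of_gram_self {x₀ : N} {y : EuclideanSpace ℝ (Fin n)}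
    (hy : y ∈ (extChartAt (𝓡 n) x₀).target) {v : EuclideanSpace ℝ (Fin n)}
    (h : gram x₀ y v v = 0) : v = 0 := by
  rw [gram_eq_inner, inner_self_eq_zero] at h
  rw [← toCoord_ofCoord ((extChartAt (𝓡 n) x₀).map_target hy) v, h]
  exact map_zero _

/-- A vector in the kernel of the matrix would have length zero, against positive definiteness. -/
theorem det_metricCoeff_ne_zero {x₀ : N} {y : EuclideanSpace ℝ (Fin n)}
    (hy : y ∈ (extChartAt (𝓡 n) x₀).target) : (metricCoeff x₀ y).det ≠ 0 := by
  intro h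
  obtain ⟨v, hv, h0⟩ := Matrix.exists_mulVec_eq_zero_iff.2 h
  apply hv
  have : (WithLp.toLp 2 v : EuclideanSpace ℝ (Fin n)) = 0 := by
    apply eq_zero_of_gram_self hy
    rw [gram_apply]
    refine Finset.sum_eq_zero fun i _ ↦ ?_
    have := congrFun h0 i
    simp only [Matrix.mulVec, dotProduct, Pi.zero_apply] at this
    calc _ = v i * ∑ j, metricCoeff x₀ y i j * v j := by
          rw [Finset.mul_sum]
          exact Finset.sum_congr rfl fun j _ ↦ by ring
      _ = 0 := by rw [this, mul_zero]
  simpa using this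

variable [IsContMDiffRiemannianBundle (𝓡 n) ∞ (EuclideanSpace ℝ (Fin n))
      (fun x : N ↦ TangentSpace (𝓡 n) x)]

theorem contDiffAt_metricCoeff {x₀ : N} {y : EuclideanSpace ℝ (Fin n)}
    (hy : y ∈ (extChartAt (𝓡 n) x₀).target) (i j : Fin n) :
    ContDiffAt ℝ ∞ (fun z ↦ metricCoeff x₀ z i j) y := by
  have hn := (isOpen_extChartAt_target (I := 𝓡 n) x₀).mem_nhds hy
  exact (ContMDiffAt.inner_bundle (F := EuclideanSpace ℝ (Fin n))
    (E := fun x : N ↦ TangentSpace (𝓡 n) x) (b := fun z ↦ (extChartAt (𝓡 n) x₀).symm z)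
    (v := fun z ↦ ofCoord x₀ ((extChartAt (𝓡 n) x₀).symm z) (EuclideanSpace.single i 1))
    (w := fun z ↦ ofCoord x₀ ((extChartAt (𝓡 n) x₀).symm z) (EuclideanSpace.single j 1))
    ((contMDiffOn_ofCoord x₀ _).contMDiffAt hn)
    ((contMDiffOn_ofCoord x₀ _).contMDiffAt hn)).contDiffAt

theorem contDiffAt_gram {x₀ : N} {y : EuclideanSpace ℝ (Fin n)}
    (hy : y ∈ (extChartAt (𝓡 n) x₀).target) : ContDiffAt ℝ ∞ (gram x₀) y := by
  unfold gram
  exact ContDiffAt.sum fun i _ ↦ ContDiffAt.sum fun j _ ↦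
    (contDiffAt_metricCoeff hy i j).smul_const_right _

theorem contDiffAt_christoffel {x₀ : N} {y : EuclideanSpace ℝ (Fin n)}
    (hy : y ∈ (extChartAt (𝓡 n) x₀).target) (k i j : Fin n) :
    ContDiffAt ℝ ∞ (christoffel x₀ k i j) y := by
  have hp : ∀ m i j, ContDiffAt ℝ ∞ (pderiv m fun z ↦ metricCoeff x₀ z i j) y := fun m i j ↦
    (contDiffAt_metricCoeff hy i j).fderiv_infty.clm_apply contDiffAt_const
  unfold christoffel
  exact contDiffAt_const.mul (ContDiffAt.sum fun l _ ↦
    (contDiffAt_matrix_inv (contDiffAt_metricCoeff hy) (det_metricCoeff_ne_zero hy) k l).mul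
      (((hp i j l).add (hp j i l)).sub (hp l i j)))

theorem contDiffAt_christoffelMap {x₀ : N} {y : EuclideanSpace ℝ (Fin n)}
    (hy : y ∈ (extChartAt (𝓡 n) x₀).target) : ContDiffAt ℝ ∞ (christoffelMap x₀) y := by
  unfold christoffelMap
  exact ContDiffAt.sum fun k _ ↦ ContDiffAt.sum fun i _ ↦ ContDiffAt.sum fun j _ ↦
    (contDiffAt_christoffel hy k i j).smul_const_right _

theorem fderiv_gram_single {x₀ : N} {y : EuclideanSpace ℝ (Fin n)}
    (hy : y ∈ (extChartAt (𝓡 n) x₀).target) (m i j : Fin n) :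
    fderiv ℝ (gram x₀) y (EuclideanSpace.single m 1) (EuclideanSpace.single i 1)
      (EuclideanSpace.single j 1) = pderiv m (fun z ↦ metricCoeff x₀ z i j) y := by
  obtain ⟨L, hL, h⟩ := hasFDerivAt_apply_const₂ ((contDiffAt_gram hy).differentiableAt (by simp))
    (EuclideanSpace.single i 1) (EuclideanSpace.single j 1)
  rw [← h, pderiv, ← hL.fderiv]
  simp only [gram_single]

/-- Lowering the upper index multiplies by the metric matrix, which cancels the inverse in
`christoffel` and leaves half the Koszul bracket. -/
theorem isKoszulAt_christoffelMap {x₀ : N} {y : EuclideanSpace ℝ (Fin n)}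
    (hy : y ∈ (extChartAt (𝓡 n) x₀).target) : IsKoszulAt (gram x₀) (christoffelMap x₀) y := by
  refine isKoszulAt_of_basis (EuclideanSpace.basisFun (Fin n) ℝ).toBasis fun i j r ↦ ?_
  simp only [OrthonormalBasis.coe_toBasis, EuclideanSpace.basisFun_apply]
  rw [fderiv_gram_single hy, fderiv_gram_single hy, fderiv_gram_single hy]
  set D : Fin n → ℝ := fun l ↦ pderiv i (fun z ↦ metricCoeff x₀ z j l) y
    + pderiv j (fun z ↦ metricCoeff x₀ z i l) y - pderiv l (fun z ↦ metricCoeff x₀ z i j) y with hD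
  have h1 : gram x₀ y (christoffelMap x₀ y (EuclideanSpace.single i 1)
      (EuclideanSpace.single j 1)) (EuclideanSpace.single r 1) =
      ∑ k, metricCoeff x₀ y r k * christoffel x₀ k i j y := by
    rw [gram_apply]
    refine Finset.sum_congr rfl fun k _ ↦ ?_
    simp [christoffelMap_apply, metricCoeff_comm x₀ y k r]
  have h2 : ∑ k, metricCoeff x₀ y r k * christoffel x₀ k i j y = 1 / 2 * D r := by
    have h3 : ∀ k, christoffel x₀ k i j y = 1 / 2 * ((metricCoeff x₀ y)⁻¹.mulVec D) k :=
      fun k ↦ rfl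
    have h4 : (metricCoeff x₀ y).mulVec ((metricCoeff x₀ y)⁻¹.mulVec D) = D := by
      rw [Matrix.mulVec_mulVec, Matrix.mul_nonsing_inv _ (det_metricCoeff_ne_zero hy).isUnit,
        Matrix.one_mulVec]
    simp only [h3]
    conv_rhs => rw [← h4]
    rw [Matrix.mulVec, dotProduct, Finset.mul_sum]
    exact Finset.sum_congr rfl fun k _ ↦ by ring
  rw [h1, h2]
  simp only [hD]
  ring

/-- The transition map is an isometry for the two coordinate metrics, since both compute the same
inner product on N. -/
theorem christoffelLaw_at {x₀ x₁ p : N} (h₀ : p ∈ (extChartAt (𝓡 n) x₀).source)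
    (h₁ : p ∈ (extChartAt (𝓡 n) x₁).source) :
    ChristoffelLaw (christoffelMap x₀) (christoffelMap x₁) (transition x₀ x₁)
      (extChartAt (𝓡 n) x₀ p) := by
  have ht₀ := (extChartAt (𝓡 n) x₀).map_source h₀
  have ht₁ := (extChartAt (𝓡 n) x₁).map_source h₁
  have htr := transition_extChartAt (x₁ := x₁) h₀
  refine christoffelLaw_of_isometry (G₀ := gram x₀) (G₁ := gram x₁) (contDiffAt_transition h₀ h₁)
    (surjective_fderiv_transition h₀ h₁) ((contDiffAt_gram ht₀).differentiableAt (by simp))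
    ?_ (fun v w ↦ gram_comm _ _ _ _) (fun v hv ↦ ?_) ?_ (isKoszulAt_christoffelMap ht₀) ?_
  · rw [htr]
    exact (contDiffAt_gram ht₁).differentiableAt (by simp)
  · rw [htr] at hv
    exact eq_zero_of_gram_self ht₁ (hv v)
  · filter_upwards [eventually_symm_mem h₀ ((isOpen_extChartAt_source x₁).mem_nhds h₁),
      eventually_mem_target h₀] with y hy hy' v w
    set q := (extChartAt (𝓡 n) x₀).symm y with hq
    have hq₀ : q ∈ (extChartAt (𝓡 n) x₀).source := (extChartAt (𝓡 n) x₀).map_target hy'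
    have hy₀ : y = extChartAt (𝓡 n) x₀ q := ((extChartAt (𝓡 n) x₀).right_inv hy').symm
    rw [hy₀, transition_extChartAt hq₀, ← toCoord_ofCoord_eq_fderiv hq₀ hy,
      ← toCoord_ofCoord_eq_fderiv hq₀ hy, gram_toCoord hy, ← gram_toCoord hq₀,
      toCoord_ofCoord hq₀, toCoord_ofCoord hq₀]
  · rw [htr]
    exact isKoszulAt_christoffelMap ht₁

/-- This frees `covDeriv` from the chart centred at c τ, which moves with τ, so that it can be
differentiated again and compared between solutions in one chart. -/
theorem toCoord_covDeriv {c : ℝ → N} {V : ∀ τ, TangentSpace (𝓡 n) (c τ)} {τ : ℝ} {x₀ : N}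
    (h : c τ ∈ (extChartAt (𝓡 n) x₀).source) (hc : ContinuousAt c τ)
    (hy : DifferentiableAt ℝ (fun x ↦ extChartAt (𝓡 n) x₀ (c x)) τ)
    (hV : DifferentiableAt ℝ (fun x ↦ toCoord x₀ (c x) (V x)) τ) :
    toCoord x₀ (c τ) (covDeriv c V τ) = localCovDeriv (christoffelMap x₀)
      (fun x ↦ extChartAt (𝓡 n) x₀ (c x)) (fun x ↦ toCoord x₀ (c x) (V x)) τ := by
  have h₁ := mem_extChartAt_source (I := 𝓡 n) (c τ)
  have e1 : covDeriv c V τ = ofCoord (c τ) (c τ) (localCovDeriv (christoffelMap (c τ))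
      (fun x ↦ extChartAt (𝓡 n) (c τ) (c x)) (fun x ↦ toCoord (c τ) (c x) (V x)) τ) := by
    unfold covDeriv localCovDeriv
    congr 2
    ext k
    rw [christoffelMap_apply]
    simp only [mul_assoc]
  have hn₀ := hc.eventually_mem ((isOpen_extChartAt_source x₀).mem_nhds h)
  have hn₁ := hc.eventually_mem ((isOpen_extChartAt_source (I := 𝓡 n) (c τ)).mem_nhds h₁)
  rw [e1, localCovDeriv_of_christoffelLaw (Φ := transition x₀ (c τ))
    (y := fun x ↦ extChartAt (𝓡 n) x₀ (c x)) (v := fun x ↦ toCoord x₀ (c x) (V x))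
    (contDiffAt_transition h h₁) (christoffelLaw_at h h₁) hy hV,
    ← toCoord_ofCoord_eq_fderiv h h₁, ofCoord_toCoord h₁, toCoord_ofCoord h]
  · filter_upwards [hn₀] with x hx using (transition_extChartAt hx).symm
  · filter_upwards [hn₀, hn₁] with x hx hx' using toCoord_eq_fderiv_toCoord hx hx' _

theorem localCurvature_christoffelMap (p : N) (u v w : EuclideanSpace ℝ (Fin n)) :
    localCurvature (christoffelMap p) (extChartAt (𝓡 n) p p) u v w =
      WithLp.toLp 2 fun m ↦ ∑ l, ∑ i, ∑ j,
        riemannCoeff p m l i j (extChartAt (𝓡 n) p p) * u i * v j * w l := by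
  set y := extChartAt (𝓡 n) p p
  have hy : y ∈ (extChartAt (𝓡 n) p).target := mem_extChartAt_target p
  have hd := (contDiffAt_christoffelMap hy).differentiableAt (by simp)
  have hD : ∀ (a v w : EuclideanSpace ℝ (Fin n)) m,
      fderiv ℝ (christoffelMap p) y a v w m = ∑ j, ∑ l,
        (∑ i, a i * pderiv i (christoffel p m j l) y) * (v j * w l) := by
    intro a v w m
    obtain ⟨L, hL, h⟩ := hasFDerivAt_apply_const₂ hd v w
    have h1 : HasFDerivAt (fun x ↦ christoffelMap p x v w m)
        ((EuclideanSpace.proj m : EuclideanSpace ℝ (Fin n) →L[ℝ] ℝ).comp L) y :=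
      (EuclideanSpace.proj m : EuclideanSpace ℝ (Fin n) →L[ℝ] ℝ).hasFDerivAt.comp y hL
    have h2 : HasFDerivAt (fun x ↦ christoffelMap p x v w m)
        (∑ j, ∑ l, (v j * w l) • fderiv ℝ (christoffel p m j l) y) y := by
      simp only [christoffelMap_apply]
      exact HasFDerivAt.fun_sum fun j _ ↦ HasFDerivAt.fun_sum fun l _ ↦
        ((contDiffAt_christoffel hy m j l).differentiableAt (by simp)).hasFDerivAt.mul_const _
    have h3 := congrArg (fun L' ↦ L' a) (h1.unique h2)
    simp only [ContinuousLinearMap.comp_apply, h, sum_apply, smul_apply, smul_eq_mul] at h3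
    refine h3.trans ?_
    refine Finset.sum_congr rfl fun j _ ↦ Finset.sum_congr rfl fun l _ ↦ ?_
    rw [mul_comm]
    congr 1
    conv_lhs => rw [← (EuclideanSpace.basisFun (Fin n) ℝ).sum_repr a]
    simp [pderiv]
  ext m
  simp only [localCurvature, PiLp.add_apply, PiLp.sub_apply, hD, riemannCoeff, christoffelMap_apply]
  exact sum_curvature_identity (fun i j l ↦ pderiv i (christoffel p m j l) y)
    (fun i r ↦ christoffel p m i r y) (fun r j l ↦ christoffel p r j l y) u v w

/-- The curvature counterpart of `toCoord_covDeriv`. Here the law is required on a neighbourhood,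
because it gets differentiated. -/
theorem toCoord_curvature {x₀ p : N} (h : p ∈ (extChartAt (𝓡 n) x₀).source)
    (X Y Z : TangentSpace (𝓡 n) p) :
    toCoord x₀ p (curvature p X Y Z) = localCurvature (christoffelMap x₀)
      (extChartAt (𝓡 n) x₀ p) (toCoord x₀ p X) (toCoord x₀ p Y) (toCoord x₀ p Z) := by
  have h₁ := mem_extChartAt_source (I := 𝓡 n) p
  have hlaw : ∀ᶠ y in 𝓝 (extChartAt (𝓡 n) x₀ p),
      ChristoffelLaw (christoffelMap x₀) (christoffelMap p) (transition x₀ p) y := by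
    filter_upwards [eventually_symm_mem h ((isOpen_extChartAt_source (I := 𝓡 n) p).mem_nhds h₁),
      eventually_mem_target h] with y hy hy'
    rw [← (extChartAt (𝓡 n) x₀).right_inv hy']
    exact christoffelLaw_at ((extChartAt (𝓡 n) x₀).map_target hy') hy
  have key := localCurvature_of_christoffelLaw (contDiffAt_transition h h₁)
    ((contDiffAt_christoffelMap ((extChartAt (𝓡 n) x₀).map_source h)).differentiableAt (by simp))
    (by
      rw [transition_extChartAt h]
      exact (contDiffAt_christoffelMap (mem_extChartAt_target p)).differentiableAt (by simp))
    hlaw (toCoord x₀ p X) (toCoord x₀ p Y) (toCoord x₀ p Z)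
  rw [transition_extChartAt h, ← toCoord_eq_fderiv_toCoord h h₁, ← toCoord_eq_fderiv_toCoord h h₁,
    ← toCoord_eq_fderiv_toCoord h h₁, localCurvature_christoffelMap] at key
  rw [curvature, ← key, ← toCoord_ofCoord_eq_fderiv h h₁, ofCoord_toCoord h₁, toCoord_ofCoord h]

end Metric

/-! ### Immersions and Lipschitz dependence. -/

section FibrewiseLinearMaps

variable {X Y V W : Type*} [NormedAddCommGroup X] [NormedSpace ℝ X] [NormedAddCommGroup Y]
  [NormedSpace ℝ Y] [NormedAddCommGroup V] [NormedSpace ℝ V] [NormedAddCommGroup W]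
  [NormedSpace ℝ W]

/-- The map of trivial vector bundles that covers `h` and is given by `A` on the fibres. -/
def fibrewise (h : X → Y) (A : X → V →L[ℝ] W) (w : X × V) : Y × W := (h w.1, A w.1 w.2)

theorem contDiffAt_fibrewise {h : X → Y} {A : X → V →L[ℝ] W} {w : X × V}
    (hh : ContDiffAt ℝ ∞ h w.1) (hA : ContDiffAt ℝ ∞ A w.1) :
    ContDiffAt ℝ ∞ (fibrewise h A) w :=
  (hh.comp w contDiffAt_fst).prodMk ((hA.comp w contDiffAt_fst).clm_apply contDiffAt_snd)

/-- The derivative is block triangular with diagonal blocks Dh and A. -/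
theorem injective_fderiv_fibrewise {h : X → Y} {A : X → V →L[ℝ] W} {w : X × V}
    (hh : ContDiffAt ℝ ∞ h w.1) (hA : ContDiffAt ℝ ∞ A w.1)
    (hh' : Function.Injective (fderiv ℝ h w.1)) (hA' : Function.Injective (A w.1)) :
    Function.Injective (fderiv ℝ (fibrewise h A) w) := by
  have h1 : HasFDerivAt (fun w : X × V ↦ h w.1) _ w :=
    (hh.differentiableAt (by simp)).hasFDerivAt.comp w hasFDerivAt_fst
  have h2 : HasFDerivAt (fun w : X × V ↦ A w.1) _ w :=
    (hA.differentiableAt (by simp)).hasFDerivAt.comp w hasFDerivAt_fst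
  have h3 : HasFDerivAt (fibrewise h A) _ w := h1.prodMk (h2.clm_apply hasFDerivAt_snd)
  rw [h3.fderiv, injective_iff_map_eq_zero]
  rintro ⟨x, v⟩ hxv
  simp only [ContinuousLinearMap.prod_apply, ContinuousLinearMap.comp_apply,
    ContinuousLinearMap.coe_fst', Prod.mk_eq_zero] at hxv
  obtain ⟨hx, hv⟩ := hxv
  have hx0 : x = 0 := (injective_iff_map_eq_zero _).1 hh' _ hx
  subst hx0
  simp only [add_apply, ContinuousLinearMap.comp_apply, ContinuousLinearMap.coe_snd',
    ContinuousLinearMap.flip_apply, ContinuousLinearMap.coe_fst', map_zero,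
    zero_apply, add_zero] at hv
  have hv0 : v = 0 := (injective_iff_map_eq_zero _).1 hA' _ hv
  rw [hv0]
  rfl

/-- In finite dimension an injective linear map is bounded below, with some constant K. Strict
differentiability controls both points of the pair at once; error 1/(2K) costs half of |p.1 - p.2|,
which is absorbed, whence 2K. -/
theorem exists_norm_sub_le_of_injective_fderiv [FiniteDimensional ℝ X] {f : X → Y} {x : X}
    (hf : ContDiffAt ℝ ∞ f x) (hinj : Function.Injective (fderiv ℝ f x)) :
    ∃ C : ℝ, 0 ≤ C ∧ ∀ᶠ p in 𝓝 (x, x), ‖p.1 - p.2‖ ≤ C * ‖f p.1 - f p.2‖ := by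
  obtain ⟨K, hK, hanti⟩ := (fderiv ℝ f x : X →ₗ[ℝ] Y).exists_antilipschitzWith
    (LinearMap.ker_eq_bot.2 hinj)
  have hs : HasStrictFDerivAt f (fderiv ℝ f x) x := hf.hasStrictFDerivAt (by simp)
  have hK' : (0 : ℝ) < K := hK
  refine ⟨2 * K, by positivity, ?_⟩
  filter_upwards [hs.isLittleO.bound (c := 1 / (2 * K)) (by positivity)] with p hp
  have h1 : ‖p.1 - p.2‖ ≤ K * ‖fderiv ℝ f x (p.1 - p.2)‖ := by
    have := hanti.le_mul_dist p.1 p.2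
    rwa [dist_eq_norm, dist_eq_norm, ← map_sub] at this
  have h2 : ‖fderiv ℝ f x (p.1 - p.2)‖ ≤
      ‖f p.1 - f p.2‖ + ‖f p.1 - f p.2 - fderiv ℝ f x (p.1 - p.2)‖ := by
    have := norm_sub_le (f p.1 - f p.2) (f p.1 - f p.2 - fderiv ℝ f x (p.1 - p.2))
    simpa using this
  have h3 : K * ‖fderiv ℝ f x (p.1 - p.2)‖ ≤
      K * (‖f p.1 - f p.2‖ + 1 / (2 * K) * ‖p.1 - p.2‖) := by
    gcongr
    linarith
  have h4 : (K : ℝ) * (‖f p.1 - f p.2‖ + 1 / (2 * K) * ‖p.1 - p.2‖) =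
      K * ‖f p.1 - f p.2‖ + ‖p.1 - p.2‖ / 2 := by
    field_simp
  linarith

/-- If `Φ` is an immersion and `K` is smooth, then `K` is locally a Lipschitz function of `Φ`. -/
theorem exists_norm_sub_le_of_immersion [FiniteDimensional ℝ X] {Z : Type*} [NormedAddCommGroup Z]
    [NormedSpace ℝ Z] {f : X → Y} {k : X → Z} {x : X} (hf : ContDiffAt ℝ ∞ f x)
    (hinj : Function.Injective (fderiv ℝ f x)) (hk : ContDiffAt ℝ ∞ k x) :
    ∃ C : ℝ, 0 ≤ C ∧ ∀ᶠ p in 𝓝 (x, x), ‖k p.1 - k p.2‖ ≤ C * ‖f p.1 - f p.2‖ := by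
  obtain ⟨C, hC, h1⟩ := exists_norm_sub_le_of_injective_fderiv hf hinj
  obtain ⟨L, t, ht, hL⟩ := (hk.of_le (m := 1) ENat.LEInfty.out).exists_lipschitzOnWith
  refine ⟨L * C, by positivity, ?_⟩
  rw [nhds_prod_eq] at h1 ⊢
  filter_upwards [h1, prod_mem_prod ht ht] with p hp hpt
  calc ‖k p.1 - k p.2‖ ≤ L * ‖p.1 - p.2‖ := hL.norm_sub_le hpt.1 hpt.2
    _ ≤ L * (C * ‖f p.1 - f p.2‖) := by gcongr
    _ = _ := by ring

theorem contDiffAt_clm_apply₂ {X' : Type*} [NormedAddCommGroup X'] [NormedSpace ℝ X']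
    {B : X' → X →L[ℝ] Y →L[ℝ] W} {f : X' → X} {g : X' → Y} {x : X'} (hB : ContDiffAt ℝ ∞ B x)
    (hf : ContDiffAt ℝ ∞ f x) (hg : ContDiffAt ℝ ∞ g x) :
    ContDiffAt ℝ ∞ (fun z ↦ B z (f z) (g z)) x :=
  (hB.clm_apply hf).clm_apply hg

theorem contDiffAt_fderiv_comp_apply {X' : Type*} [NormedAddCommGroup X'] [NormedSpace ℝ X']
    {h : X → Y} {f g : X' → X} {x : X'} (hh : ContDiffAt ℝ ∞ h (f x))
    (hf : ContDiffAt ℝ ∞ f x) (hg : ContDiffAt ℝ ∞ g x) :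
    ContDiffAt ℝ ∞ (fun z ↦ fderiv ℝ h (f z) (g z)) x :=
  (hh.fderiv_infty.comp x hf).clm_apply hg

theorem contDiffAt_comp_clm₂ {X' : Type*} [NormedAddCommGroup X'] [NormedSpace ℝ X']
    {Γ : X → Y →L[ℝ] V →L[ℝ] W} {y : X' → X} {u : X' → Y} {v : X' → V} {x : X'}
    (hy : ContDiffAt ℝ ∞ y x) (hΓ : ContDiffAt ℝ ∞ Γ (y x)) (hu : ContDiffAt ℝ ∞ u x)
    (hv : ContDiffAt ℝ ∞ v x) : ContDiffAt ℝ ∞ (fun z ↦ Γ (y z) (u z) (v z)) x :=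
  contDiffAt_clm_apply₂ (hΓ.comp x hy) hu hv

theorem contDiffAt_fderiv_comp_clm₂ {X' : Type*} [NormedAddCommGroup X'] [NormedSpace ℝ X']
    {Γ : X → Y →L[ℝ] V →L[ℝ] W} {y y' : X' → X} {u : X' → Y} {v : X' → V} {x : X'}
    (hy : ContDiffAt ℝ ∞ y x) (hΓ : ContDiffAt ℝ ∞ Γ (y x)) (hy' : ContDiffAt ℝ ∞ y' x)
    (hu : ContDiffAt ℝ ∞ u x) (hv : ContDiffAt ℝ ∞ v x) :
    ContDiffAt ℝ ∞ (fun z ↦ fderiv ℝ Γ (y z) (y' z) (u z) (v z)) x :=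
  contDiffAt_clm_apply₂ (contDiffAt_fderiv_comp_apply (Y := Y →L[ℝ] V →L[ℝ] W) hΓ hy hy') hu hv

theorem hasDerivAt_comp_clm {Γ : X → Y →L[ℝ] W} {y : ℝ → X} {y' : X} {s : ℝ}
    (hΓ : ContDiffAt ℝ ∞ Γ (y s)) (hy : HasDerivAt y y' s) :
    HasDerivAt (fun z ↦ Γ (y z)) (fderiv ℝ Γ (y s) y') s :=
  (hΓ.differentiableAt (by simp)).hasFDerivAt.comp_hasDerivAt s hy

theorem hasDerivAt_comp_clm₂ {Γ : X → Y →L[ℝ] V →L[ℝ] W} {y : ℝ → X} {u : ℝ → Y} {v : ℝ → V}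
    {y' : X} {u' : Y} {v' : V} {s : ℝ}
    (hΓ : ContDiffAt ℝ ∞ Γ (y s)) (hy : HasDerivAt y y' s) (hu : HasDerivAt u u' s)
    (hv : HasDerivAt v v' s) : HasDerivAt (fun z ↦ Γ (y z) (u z) (v z))
      (fderiv ℝ Γ (y s) y' (u s) (v s) + Γ (y s) u' (v s) + Γ (y s) (u s) v') s := by
  simpa [add_assoc] using ((hasDerivAt_comp_clm (W := V →L[ℝ] W) hΓ hy).clm_apply hu).clm_apply hv

end FibrewiseLinearMaps

/-! ### Lower order terms of the flow in coordinates. -/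

section LocalFlow

variable {E : Type*} [NormedAddCommGroup E] [NormedSpace ℝ E]

theorem contDiffAt_localCurvature {X' : Type*} [NormedAddCommGroup X'] [NormedSpace ℝ X']
    {Γ : E → E →L[ℝ] E →L[ℝ] E} {y u v w : X' → E} {x : X'} (hy : ContDiffAt ℝ ∞ y x)
    (hΓ : ContDiffAt ℝ ∞ Γ (y x)) (hu : ContDiffAt ℝ ∞ u x) (hv : ContDiffAt ℝ ∞ v x)
    (hw : ContDiffAt ℝ ∞ w x) :
    ContDiffAt ℝ ∞ (fun z ↦ localCurvature Γ (y z) (u z) (v z) (w z)) x :=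
  ((contDiffAt_fderiv_comp_clm₂ hy hΓ hu hv hw).sub
    (contDiffAt_fderiv_comp_clm₂ hy hΓ hv hu hw)).add
    ((contDiffAt_comp_clm₂ hy hΓ hu (contDiffAt_comp_clm₂ hy hΓ hv hw)).sub
      (contDiffAt_comp_clm₂ hy hΓ hv (contDiffAt_comp_clm₂ hy hΓ hu hw)))

/-- The lower order terms in the evolution equation of the curve, in local coordinates. Here
`y' = ∂y/∂s` and `a'`, `b'` are the derivatives of the components `a`, `b` of the spinor. -/
def curveTerm (κ ε : ℝ) (Γ : E → E →L[ℝ] E →L[ℝ] E) (y a b y' a' b' : E) : E :=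
  Γ y y' y' - κ • (1 / 2 : ℝ) • (localCurvature Γ y (-b) a y' + localCurvature Γ y a b y')
    - ε • κ • (localCurvature Γ y (a' + Γ y y' a) a y' + localCurvature Γ y (b' + Γ y y' b) b y')

/-- The lower order terms in the connection Laplacian along a curve with velocity `y'`, with the
second derivative of the curve replaced by its time derivative up to the term `f`. -/
def laplacianTerm (Γ : E → E →L[ℝ] E →L[ℝ] E) (y a y' a' f : E) : E :=
  fderiv ℝ Γ y y' y' a + Γ y y' a' + Γ y y' (a' + Γ y y' a) - Γ y f a

/-- The lower order terms of the flow in local coordinates: `z = ((y, a), b)`, where `y` is the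
curve and `a`, `b` are the components of the spinor, and `p = ∂z/∂s`. -/
def flowTerm (κ ε : ℝ) (Γ : E → E →L[ℝ] E →L[ℝ] E) (z p : (E × E) × E) : (E × E) × E :=
  ((curveTerm κ ε Γ z.1.1 z.1.2 z.2 p.1.1 p.1.2 p.2,
    laplacianTerm Γ z.1.1 z.1.2 p.1.1 p.1.2 (curveTerm κ ε Γ z.1.1 z.1.2 z.2 p.1.1 p.1.2 p.2)
      + (1 / ε) • (p.2 + Γ z.1.1 p.1.1 z.2)),
    laplacianTerm Γ z.1.1 z.2 p.1.1 p.2 (curveTerm κ ε Γ z.1.1 z.1.2 z.2 p.1.1 p.1.2 p.2)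
      - (1 / ε) • (p.1.2 + Γ z.1.1 p.1.1 z.1.2))

/-- Base-point dependence enters only through Γ and its first derivative; everything else is
polynomial in z and p. -/
theorem contDiffAt_flowTerm {κ ε : ℝ} {Γ : E → E →L[ℝ] E →L[ℝ] E}
    {w : ((E × E) × E) × ((E × E) × E)} (hΓ : ContDiffAt ℝ ∞ Γ w.1.1.1) :
    ContDiffAt ℝ ∞ (fun w : ((E × E) × E) × ((E × E) × E) ↦ flowTerm κ ε Γ w.1 w.2) w := by
  have y : ContDiffAt ℝ ∞ (fun w : ((E × E) × E) × ((E × E) × E) ↦ w.1.1.1) w := by fun_prop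
  have a : ContDiffAt ℝ ∞ (fun w : ((E × E) × E) × ((E × E) × E) ↦ w.1.1.2) w := by fun_prop
  have b : ContDiffAt ℝ ∞ (fun w : ((E × E) × E) × ((E × E) × E) ↦ w.1.2) w := by fun_prop
  have y' : ContDiffAt ℝ ∞ (fun w : ((E × E) × E) × ((E × E) × E) ↦ w.2.1.1) w := by fun_prop
  have a' : ContDiffAt ℝ ∞ (fun w : ((E × E) × E) × ((E × E) × E) ↦ w.2.1.2) w := by fun_prop
  have b' : ContDiffAt ℝ ∞ (fun w : ((E × E) × E) × ((E × E) × E) ↦ w.2.2) w := by fun_prop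
  have na := a'.add (contDiffAt_comp_clm₂ y hΓ y' a)
  have nb := b'.add (contDiffAt_comp_clm₂ y hΓ y' b)
  have c : ContDiffAt ℝ ∞ (fun w : ((E × E) × E) × ((E × E) × E) ↦
      curveTerm κ ε Γ w.1.1.1 w.1.1.2 w.1.2 w.2.1.1 w.2.1.2 w.2.2) w :=
    ((contDiffAt_comp_clm₂ y hΓ y' y').sub
      (((contDiffAt_localCurvature y hΓ b.neg a y').add
        (contDiffAt_localCurvature y hΓ a b y')).const_smul (1 / 2 : ℝ) |>.const_smul κ)).sub
      (((contDiffAt_localCurvature y hΓ na a y').add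
        (contDiffAt_localCurvature y hΓ nb b y')).const_smul κ |>.const_smul ε)
  have l1 := (((contDiffAt_fderiv_comp_clm₂ y hΓ y' y' a).add
    (contDiffAt_comp_clm₂ y hΓ y' a')).add (contDiffAt_comp_clm₂ y hΓ y' na)).sub
      (contDiffAt_comp_clm₂ y hΓ c a)
  have l2 := (((contDiffAt_fderiv_comp_clm₂ y hΓ y' y' b).add
    (contDiffAt_comp_clm₂ y hΓ y' b')).add (contDiffAt_comp_clm₂ y hΓ y' nb)).sub
      (contDiffAt_comp_clm₂ y hΓ c b)
  exact (c.prodMk (l1.add (nb.const_smul (1 / ε)))).prodMk (l2.sub (na.const_smul (1 / ε)))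

end LocalFlow

/-! ### Chain rules along the space and time directions. -/

section Slices

variable {X Y : Type*} [NormedAddCommGroup X] [NormedSpace ℝ X]
  [NormedAddCommGroup Y] [NormedSpace ℝ Y] {J : Set ℝ} {q : ℝ × ℝ}

theorem eventually_slice_fst {P : ℝ × ℝ → Prop} (h : ∀ᶠ r in 𝓝[univ ×ˢ J] q, P r)
    (hq : q.2 ∈ J) : ∀ᶠ s in 𝓝 q.1, P (s, q.2) := by
  have h1 : Tendsto (fun s : ℝ ↦ (s, q.2)) (𝓝 q.1) (𝓝[univ ×ˢ J] q) :=
    tendsto_nhdsWithin_iff.2 ⟨(continuous_id.prodMk continuous_const).tendsto q.1,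
      Eventually.of_forall fun s ↦ ⟨mem_univ _, hq⟩⟩
  exact h1.eventually h

theorem hasDerivAt_slice {f : ℝ × ℝ → X} (hf : ContDiffWithinAt ℝ ∞ f (univ ×ˢ J) q)
    (hq : q.2 ∈ J) : HasDerivAt (fun s ↦ f (s, q.2)) (ds f q) q.1 :=
  (hasDerivAt_slice_fst (hf.differentiableWithinAt (by simp)) hq).differentiableAt.hasDerivAt

theorem hasDerivAt_slice_time {f : ℝ × ℝ → X} (hf : ContDiffWithinAt ℝ ∞ f (univ ×ˢ J) q)
    (hq : J ∈ 𝓝 q.2) : HasDerivAt (fun t ↦ f (q.1, t)) (dt f q) q.2 :=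
  (hasDerivAt_slice_snd (hf.differentiableWithinAt (by simp)) hq).differentiableAt.hasDerivAt

theorem eventually_hasDerivAt_slice {f : ℝ × ℝ → X} (hf : ContDiffWithinAt ℝ ∞ f (univ ×ˢ J) q)
    (hq : q.2 ∈ J) :
    ∀ᶠ r in 𝓝[univ ×ˢ J] q, HasDerivAt (fun s ↦ f (s, r.2)) (ds f r) r.1 := by
  filter_upwards [eventually_differentiableWithinAt hf ⟨mem_univ _, hq⟩, self_mem_nhdsWithin]
    with r hr hrS
  exact (hasDerivAt_slice_fst hr hrS.2).differentiableAt.hasDerivAt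

theorem ds_comp {H : X → Y} {z : ℝ × ℝ → X} {u : ℝ × ℝ → Y}
    (hH : DifferentiableAt ℝ H (z q)) (hz : HasDerivAt (fun s ↦ z (s, q.2)) (ds z q) q.1)
    (hu : ∀ᶠ s in 𝓝 q.1, u (s, q.2) = H (z (s, q.2))) :
    ds u q = fderiv ℝ H (z q) (ds z q) := by
  have h : HasDerivAt (fun s ↦ H (z (s, q.2))) (fderiv ℝ H (z q) (ds z q)) q.1 :=
    HasFDerivAt.comp_hasDerivAt q.1 hH.hasFDerivAt hz
  rw [ds, EventuallyEq.deriv_eq (f := fun s ↦ H (z (s, q.2))) hu]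
  exact h.deriv

theorem dt_comp {H : X → Y} {z : ℝ × ℝ → X} {u : ℝ × ℝ → Y}
    (hH : DifferentiableAt ℝ H (z q)) (hz : HasDerivAt (fun t ↦ z (q.1, t)) (dt z q) q.2)
    (hu : ∀ᶠ t in 𝓝 q.2, u (q.1, t) = H (z (q.1, t))) :
    dt u q = fderiv ℝ H (z q) (dt z q) := by
  have h : HasDerivAt (fun t ↦ H (z (q.1, t))) (fderiv ℝ H (z q) (dt z q)) q.2 :=
    HasFDerivAt.comp_hasDerivAt q.2 hH.hasFDerivAt hz
  rw [dt, EventuallyEq.deriv_eq (f := fun t ↦ H (z (q.1, t))) hu]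
  exact h.deriv

theorem ds_ds_comp {H : X → Y} {z : ℝ × ℝ → X} {u : ℝ × ℝ → Y} (hJ : UniqueDiffOn ℝ J)
    (hH : ContDiffAt ℝ ∞ H (z q)) (hz : ContDiffWithinAt ℝ ∞ z (univ ×ˢ J) q) (hq : q.2 ∈ J)
    (hu : ∀ᶠ r in 𝓝[univ ×ˢ J] q, u r = H (z r)) :
    ds (ds u) q = fderiv ℝ (fderiv ℝ H) (z q) (ds z q) (ds z q)
      + fderiv ℝ H (z q) (ds (ds z) q) := by
  have hHd : ∀ᶠ r in 𝓝[univ ×ˢ J] q, DifferentiableAt ℝ H (z r) := by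
    refine hz.continuousWithinAt.eventually (p := fun x ↦ DifferentiableAt ℝ H x) ?_
    filter_upwards [(hH.of_le (m := 1) ENat.LEInfty.out).eventually (by simp)] with x hx
      using hx.differentiableAt one_ne_zero
  have hu' : ∀ᶠ r in 𝓝[univ ×ˢ J] q, ds u r = fderiv ℝ H (z r) (ds z r) := by
    filter_upwards [hHd, eventually_hasDerivAt_slice hz hq,
      eventually_eventually_nhdsWithin.2 hu, self_mem_nhdsWithin] with r h1 h2 h3 h4
    exact ds_comp h1 h2 (eventually_slice_fst h3 h4.2)
  have h1 : HasDerivAt (fun s ↦ fderiv ℝ H (z (s, q.2)))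
      (fderiv ℝ (fderiv ℝ H) (z q) (ds z q)) q.1 :=
    HasFDerivAt.comp_hasDerivAt q.1 (hH.fderiv_infty.differentiableAt (by simp)).hasFDerivAt
      (hasDerivAt_slice hz hq)
  have h2 := h1.clm_apply (hasDerivAt_slice (contDiffWithinAt_ds hJ hz hq) hq)
  rw [ds, EventuallyEq.deriv_eq (f := fun s ↦ fderiv ℝ H (z (s, q.2)) (ds z (s, q.2)))
    (eventually_slice_fst hu' hq)]
  exact h2.deriv

end Slices

/-! ### Tension field and second covariant derivative in a chart. -/

section CurveCoordinates

variable {n : ℕ} {N : Type*} [TopologicalSpace N] [ChartedSpace (EuclideanSpace ℝ (Fin n)) N]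
  [IsManifold (𝓡 n) ∞ N] [RiemannianBundle (fun x : N ↦ TangentSpace (𝓡 n) x)]
  [IsContMDiffRiemannianBundle (𝓡 n) ∞ (EuclideanSpace ℝ (Fin n))
      (fun x : N ↦ TangentSpace (𝓡 n) x)]

theorem localCovDeriv_congr {E : Type*} [NormedAddCommGroup E] [NormedSpace ℝ E]
    {Γ : E → E →L[ℝ] E →L[ℝ] E} {y v w : ℝ → E} {τ : ℝ} (h : v =ᶠ[𝓝 τ] w) :
    localCovDeriv Γ y v τ = localCovDeriv Γ y w τ := by
  rw [localCovDeriv, localCovDeriv, h.deriv_eq, h.eq_of_nhds]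

theorem contDiffAt_deriv {E : Type*} [NormedAddCommGroup E] [NormedSpace ℝ E] {f : ℝ → E} {s : ℝ}
    (hf : ContDiffAt ℝ ∞ f s) : ContDiffAt ℝ ∞ (deriv f) s := by
  have h : deriv f = fun x ↦ fderiv ℝ f x 1 := funext fun x ↦ fderiv_apply_one_eq_deriv.symm
  rw [h]
  exact hf.fderiv_infty.clm_apply contDiffAt_const

theorem toCoord_tension {c : ℝ → N} (hc : ContMDiff 𝓘(ℝ, ℝ) (𝓡 n) ∞ c) {s : ℝ} {x₀ : N}
    (h : c s ∈ (extChartAt (𝓡 n) x₀).source) :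
    toCoord x₀ (c s) (tension c s) =
      deriv (deriv fun x ↦ extChartAt (𝓡 n) x₀ (c x)) s
        + christoffelMap x₀ (extChartAt (𝓡 n) x₀ (c s))
          (deriv (fun x ↦ extChartAt (𝓡 n) x₀ (c x)) s)
          (deriv (fun x ↦ extChartAt (𝓡 n) x₀ (c x)) s) := by
  have hn : ∀ᶠ x in 𝓝 s, c x ∈ (extChartAt (𝓡 n) x₀).source :=
    hc.continuous.continuousAt.eventually_mem ((isOpen_extChartAt_source x₀).mem_nhds h)
  have hy : ContDiffAt ℝ ∞ (fun x ↦ extChartAt (𝓡 n) x₀ (c x)) s :=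
    contDiffWithinAt_univ.1 (contDiffWithinAt_extChartAt_comp (hc s).contMDiffWithinAt h)
  have hv : (fun x ↦ toCoord x₀ (c x) (velocity c x)) =ᶠ[𝓝 s]
      deriv fun x ↦ extChartAt (𝓡 n) x₀ (c x) := by
    filter_upwards [hn] with x hx
    exact toCoord_velocity ((hc x).mdifferentiableAt (by simp)) hx
  have hy' : DifferentiableAt ℝ (deriv fun x ↦ extChartAt (𝓡 n) x₀ (c x)) s :=
    (contDiffAt_deriv hy).differentiableAt (by simp)
  rw [tension, toCoord_covDeriv h hc.continuous.continuousAt (hy.differentiableAt (by simp))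
    (hv.differentiableAt_iff.2 hy'), localCovDeriv_congr hv]
  rfl

theorem toCoord_covDeriv_of_contMDiff {c : ℝ → N} {V : ∀ τ, TangentSpace (𝓡 n) (c τ)}
    (hV : ContMDiff 𝓘(ℝ, ℝ) (𝓡 n).tangent ∞
      (fun x ↦ (⟨c x, V x⟩ : TangentBundle (𝓡 n) N)))
    (hc : ContMDiff 𝓘(ℝ, ℝ) (𝓡 n) ∞ c) {s : ℝ} {x₀ : N}
    (h : c s ∈ (extChartAt (𝓡 n) x₀).source) :
    toCoord x₀ (c s) (covDeriv c V s) = localCovDeriv (christoffelMap x₀)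
      (fun x ↦ extChartAt (𝓡 n) x₀ (c x)) (fun x ↦ toCoord x₀ (c x) (V x)) s :=
  toCoord_covDeriv h hc.continuous.continuousAt
    ((contDiffWithinAt_univ.1 (contDiffWithinAt_extChartAt_comp
      (hc s).contMDiffWithinAt h)).differentiableAt (by simp))
    ((contDiffWithinAt_univ.1 (contDiffWithinAt_toCoord
      (hV s).contMDiffWithinAt h)).differentiableAt (by simp))

/-- The second derivative of the curve appears in a single term, kept visible here because the time
derivative will cancel it. -/
theorem toCoord_covDeriv_covDeriv {c : ℝ → N} {V : ∀ τ, TangentSpace (𝓡 n) (c τ)}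
    (hV : ContMDiff 𝓘(ℝ, ℝ) (𝓡 n).tangent ∞
      (fun x ↦ (⟨c x, V x⟩ : TangentBundle (𝓡 n) N)))
    (hc : ContMDiff 𝓘(ℝ, ℝ) (𝓡 n) ∞ c) {s : ℝ} {x₀ : N}
    (h : c s ∈ (extChartAt (𝓡 n) x₀).source) {y v : ℝ → EuclideanSpace ℝ (Fin n)}
    (hy : y = fun x ↦ extChartAt (𝓡 n) x₀ (c x)) (hv : v = fun x ↦ toCoord x₀ (c x) (V x)) :
    toCoord x₀ (c s) (covDeriv c (covDeriv c V) s) =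
      deriv (deriv v) s + (fderiv ℝ (christoffelMap x₀) (y s) (deriv y s) (deriv y s) (v s)
        + christoffelMap x₀ (y s) (deriv (deriv y) s) (v s)
        + christoffelMap x₀ (y s) (deriv y s) (deriv v s))
      + christoffelMap x₀ (y s) (deriv y s)
        (deriv v s + christoffelMap x₀ (y s) (deriv y s) (v s)) := by
  have hn : ∀ᶠ x in 𝓝 s, c x ∈ (extChartAt (𝓡 n) x₀).source :=
    hc.continuous.continuousAt.eventually_mem ((isOpen_extChartAt_source x₀).mem_nhds h)
  have hys : ContDiffAt ℝ ∞ y s := by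
    rw [hy]
    exact contDiffWithinAt_univ.1 (contDiffWithinAt_extChartAt_comp (hc s).contMDiffWithinAt h)
  have hvs : ContDiffAt ℝ ∞ v s := by
    rw [hv]
    exact contDiffWithinAt_univ.1 (contDiffWithinAt_toCoord (hV s).contMDiffWithinAt h)
  have hΓ : ContDiffAt ℝ ∞ (christoffelMap x₀) (y s) := by
    rw [hy]
    exact contDiffAt_christoffelMap ((extChartAt (𝓡 n) x₀).map_source h)
  have hcov : (fun x ↦ toCoord x₀ (c x) (covDeriv c V x)) =ᶠ[𝓝 s]
      fun x ↦ deriv v x + christoffelMap x₀ (y x) (deriv y x) (v x) := by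
    filter_upwards [hn] with x hx
    rw [toCoord_covDeriv_of_contMDiff hV hc hx, hy, hv]
    rfl
  have hd := (contDiffAt_deriv hvs).differentiableAt (by simp) |>.hasDerivAt.add
    (hasDerivAt_comp_clm₂ hΓ (hys.differentiableAt (by simp)).hasDerivAt
      ((contDiffAt_deriv hys).differentiableAt (by simp)).hasDerivAt
      (hvs.differentiableAt (by simp)).hasDerivAt)
  have hyd := hys.differentiableAt (by simp)
  rw [hy] at hyd
  rw [toCoord_covDeriv h hc.continuous.continuousAt hyd
    (hcov.differentiableAt_iff.2 hd.differentiableAt), localCovDeriv_congr hcov, localCovDeriv]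
  subst hy
  congr 1
  exact hd.deriv

end CurveCoordinates

/-! ### The flow as a semilinear heat system in a chart. -/

section SolutionCoordinates

/-- The cancellation that decouples the leading part: the Laplacian contributes Γ(y'')a, the
covariant time derivative Γ(y_t)a, and the curve equation y_t = y'' + f leaves only -Γ(f)a. -/
theorem add_laplacianTerm {E : Type*} [NormedAddCommGroup E] [NormedSpace ℝ E]
    (Γ : E → E →L[ℝ] E →L[ℝ] E) (y a y' a' y'' a'' f : E) :
    a'' + (fderiv ℝ Γ y y' y' a + Γ y y'' a + Γ y y' a') + Γ y y' (a' + Γ y y' a)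
      - Γ y (y'' + f) a = a'' + laplacianTerm Γ y a y' a' f := by
  rw [laplacianTerm, map_add (Γ y), add_apply]
  abel

variable {n : ℕ} {N : Type*} [TopologicalSpace N] [ChartedSpace (EuclideanSpace ℝ (Fin n)) N]
  [IsManifold (𝓡 n) ∞ N] [RiemannianBundle (fun x : N ↦ TangentSpace (𝓡 n) x)]

theorem ds_congr {X : Type*} [NormedAddCommGroup X] [NormedSpace ℝ X] {J : Set ℝ} {q : ℝ × ℝ}
    {u v : ℝ × ℝ → X} (h : ∀ᶠ r in 𝓝[univ ×ˢ J] q, u r = v r) (hq : q.2 ∈ J) :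
    ds u q = ds v q :=
  EventuallyEq.deriv_eq (eventually_slice_fst h hq)

theorem ds_ds_prodMk {X Y : Type*} [NormedAddCommGroup X] [NormedSpace ℝ X]
    [NormedAddCommGroup Y] [NormedSpace ℝ Y] {J : Set ℝ} (hJ : UniqueDiffOn ℝ J) {q : ℝ × ℝ}
    {f : ℝ × ℝ → X} {g : ℝ × ℝ → Y} (hf : ContDiffWithinAt ℝ ∞ f (univ ×ˢ J) q)
    (hg : ContDiffWithinAt ℝ ∞ g (univ ×ˢ J) q) (hq : q.2 ∈ J) :
    ds (fun r ↦ (f r, g r)) q = (ds f q, ds g q) ∧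
      ds (ds fun r ↦ (f r, g r)) q = (ds (ds f) q, ds (ds g) q) := by
  refine ⟨((hasDerivAt_slice hf hq).prodMk (hasDerivAt_slice hg hq)).deriv, ?_⟩
  rw [ds_congr (v := fun r ↦ (ds f r, ds g r)) _ hq]
  · exact ((hasDerivAt_slice (contDiffWithinAt_ds hJ hf hq) hq).prodMk
      (hasDerivAt_slice (contDiffWithinAt_ds hJ hg hq) hq)).deriv
  · filter_upwards [eventually_hasDerivAt_slice hf hq, eventually_hasDerivAt_slice hg hq]
      with r h1 h2 using (h1.prodMk h2).deriv

/-- The coordinates `((y, a), b)` of a curve and a spinor field along it, where `y` is the curve and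
`a`, `b` are the components of the real and imaginary part of the spinor. -/
def coordState (x₀ : N) (γ : ℝ → ℝ → N) (ψ : ∀ s t, TwistedFibre n (γ s t)) (q : ℝ × ℝ) :
    (EuclideanSpace ℝ (Fin n) × EuclideanSpace ℝ (Fin n)) × EuclideanSpace ℝ (Fin n) :=
  ((extChartAt (𝓡 n) x₀ (γ q.1 q.2), toCoord x₀ (γ q.1 q.2) (ψ q.1 q.2).1),
    toCoord x₀ (γ q.1 q.2) (ψ q.1 q.2).2)

variable {σ : SpinStructure} {κ ε : ℝ} {T : EReal} {γ : ℝ → ℝ → N}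
  {ψ : ∀ s t, TwistedFibre n (γ s t)} {x₀ : N} {q : ℝ × ℝ}

namespace IsSmoothSolution

theorem contDiffWithinAt_curve (h : IsSmoothSolution σ κ ε T γ ψ) (hq : q.2 ∈ timeInterval T)
    (hx : γ q.1 q.2 ∈ (extChartAt (𝓡 n) x₀).source) :
    ContDiffWithinAt ℝ ∞ (fun r : ℝ × ℝ ↦ extChartAt (𝓡 n) x₀ (γ r.1 r.2))
      (univ ×ˢ timeInterval T) q :=
  contDiffWithinAt_extChartAt_comp (h.smooth_curve q ⟨mem_univ _, hq⟩) hx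

theorem contDiffWithinAt_re (h : IsSmoothSolution σ κ ε T γ ψ) (hq : q.2 ∈ timeInterval T)
    (hx : γ q.1 q.2 ∈ (extChartAt (𝓡 n) x₀).source) :
    ContDiffWithinAt ℝ ∞ (fun r : ℝ × ℝ ↦ toCoord x₀ (γ r.1 r.2) (ψ r.1 r.2).1)
      (univ ×ˢ timeInterval T) q :=
  contDiffWithinAt_toCoord (h.smooth_spinor_re q ⟨mem_univ _, hq⟩) hx

theorem contDiffWithinAt_im (h : IsSmoothSolution σ κ ε T γ ψ) (hq : q.2 ∈ timeInterval T)
    (hx : γ q.1 q.2 ∈ (extChartAt (𝓡 n) x₀).source) :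
    ContDiffWithinAt ℝ ∞ (fun r : ℝ × ℝ ↦ toCoord x₀ (γ r.1 r.2) (ψ r.1 r.2).2)
      (univ ×ˢ timeInterval T) q :=
  contDiffWithinAt_toCoord (h.smooth_spinor_im q ⟨mem_univ _, hq⟩) hx

theorem contDiffWithinAt_coordState (h : IsSmoothSolution σ κ ε T γ ψ) (hq : q.2 ∈ timeInterval T)
    (hx : γ q.1 q.2 ∈ (extChartAt (𝓡 n) x₀).source) :
    ContDiffWithinAt ℝ ∞ (coordState x₀ γ ψ) (univ ×ˢ timeInterval T) q :=
  ((h.contDiffWithinAt_curve hq hx).prodMk (h.contDiffWithinAt_re hq hx)).prodMk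
    (h.contDiffWithinAt_im hq hx)

theorem contMDiff_slice (h : IsSmoothSolution σ κ ε T γ ψ) {t : ℝ} (ht : t ∈ timeInterval T) :
    ContMDiff 𝓘(ℝ, ℝ) (𝓡 n) ∞ (fun s ↦ γ s t) :=
  h.smooth_curve.comp_contMDiff (f := fun s : ℝ ↦ (s, t))
    (contDiff_id.prodMk contDiff_const).contMDiff fun _ ↦ ⟨mem_univ _, ht⟩

theorem contMDiff_slice_re (h : IsSmoothSolution σ κ ε T γ ψ) {t : ℝ} (ht : t ∈ timeInterval T) :
    ContMDiff 𝓘(ℝ, ℝ) (𝓡 n).tangent ∞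
      (fun s ↦ (⟨γ s t, (ψ s t).1⟩ : TangentBundle (𝓡 n) N)) :=
  h.smooth_spinor_re.comp_contMDiff (f := fun s : ℝ ↦ (s, t))
    (contDiff_id.prodMk contDiff_const).contMDiff fun _ ↦ ⟨mem_univ _, ht⟩

theorem contMDiff_slice_im (h : IsSmoothSolution σ κ ε T γ ψ) {t : ℝ} (ht : t ∈ timeInterval T) :
    ContMDiff 𝓘(ℝ, ℝ) (𝓡 n).tangent ∞
      (fun s ↦ (⟨γ s t, (ψ s t).2⟩ : TangentBundle (𝓡 n) N)) :=
  h.smooth_spinor_im.comp_contMDiff (f := fun s : ℝ ↦ (s, t))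
    (contDiff_id.prodMk contDiff_const).contMDiff fun _ ↦ ⟨mem_univ _, ht⟩

theorem mdifferentiableAt_time (h : IsSmoothSolution σ κ ε T γ ψ) (hq : q.2 ∈ timeInterval T)
    (h0 : 0 < q.2) : MDifferentiableAt 𝓘(ℝ, ℝ) (𝓡 n) (fun t ↦ γ q.1 t) q.2 := by
  have h1 : ContMDiffAt 𝓘(ℝ, ℝ × ℝ) (𝓡 n) ∞ (fun r : ℝ × ℝ ↦ γ r.1 r.2) (q.1, q.2) :=
    h.smooth_curve.contMDiffAt (prod_mem_nhds univ_mem (timeInterval_mem_nhds hq h0))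
  have h2 : ContMDiffAt 𝓘(ℝ, ℝ) 𝓘(ℝ, ℝ × ℝ) ∞ (fun t : ℝ ↦ (q.1, t)) q.2 :=
    (contDiff_const.prodMk contDiff_id).contMDiff q.2
  exact (h1.comp q.2 h2).mdifferentiableAt (by simp)

variable [IsContMDiffRiemannianBundle (𝓡 n) ∞ (EuclideanSpace ℝ (Fin n))
      (fun x : N ↦ TangentSpace (𝓡 n) x)]

set_option maxHeartbeats 1000000 in
/-- The evolution equations in local coordinates. -/
theorem dt_coordState (h : IsSmoothSolution σ κ ε T γ ψ) (hq : q.2 ∈ timeInterval T)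
    (h0 : 0 < q.2) (hx : γ q.1 q.2 ∈ (extChartAt (𝓡 n) x₀).source) :
    dt (coordState x₀ γ ψ) q = ds (ds (coordState x₀ γ ψ)) q +
      flowTerm κ ε (christoffelMap x₀) (coordState x₀ γ ψ q) (ds (coordState x₀ γ ψ) q) := by
  have hT : 0 < T := lt_of_le_of_lt (by exact_mod_cast hq.1) hq.2
  have hJ := uniqueDiffOn_timeInterval hT
  have hJq := timeInterval_mem_nhds hq h0
  set Γ : EuclideanSpace ℝ (Fin n) → EuclideanSpace ℝ (Fin n) →L[ℝ]
    EuclideanSpace ℝ (Fin n) →L[ℝ] EuclideanSpace ℝ (Fin n) := christoffelMap x₀ with hΓ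
  set y : ℝ × ℝ → EuclideanSpace ℝ (Fin n) := fun r ↦ extChartAt (𝓡 n) x₀ (γ r.1 r.2) with hy
  set a : ℝ × ℝ → EuclideanSpace ℝ (Fin n) := fun r ↦ toCoord x₀ (γ r.1 r.2) (ψ r.1 r.2).1 with ha
  set b : ℝ × ℝ → EuclideanSpace ℝ (Fin n) := fun r ↦ toCoord x₀ (γ r.1 r.2) (ψ r.1 r.2).2 with hb
  have cy := h.contDiffWithinAt_curve hq hx
  have ca := h.contDiffWithinAt_re hq hx
  have cb := h.contDiffWithinAt_im hq hx
  have hz : coordState x₀ γ ψ = fun r ↦ ((y r, a r), b r) := rfl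
  have hcont : ContinuousAt (fun t ↦ γ q.1 t) q.2 := (h.mdifferentiableAt_time hq h0).continuousAt
  have ty := hasDerivAt_slice_time cy hJq
  have ta := hasDerivAt_slice_time ca hJq
  have tb := hasDerivAt_slice_time cb hJq
  have na : toCoord x₀ (γ q.1 q.2) (covDeriv (fun s ↦ γ s q.2) (fun s ↦ (ψ s q.2).1) q.1) =
      ds a q + Γ (y q) (ds y q) (a q) :=
    toCoord_covDeriv_of_contMDiff (h.contMDiff_slice_re hq) (h.contMDiff_slice hq) hx
  have nb : toCoord x₀ (γ q.1 q.2) (covDeriv (fun s ↦ γ s q.2) (fun s ↦ (ψ s q.2).2) q.1) =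
      ds b q + Γ (y q) (ds y q) (b q) :=
    toCoord_covDeriv_of_contMDiff (h.contMDiff_slice_im hq) (h.contMDiff_slice hq) hx
  have la : toCoord x₀ (γ q.1 q.2)
      (covDeriv (fun s ↦ γ s q.2) (covDeriv (fun s ↦ γ s q.2) fun s ↦ (ψ s q.2).1) q.1) =
      ds (ds a) q + (fderiv ℝ Γ (y q) (ds y q) (ds y q) (a q) + Γ (y q) (ds (ds y) q) (a q)
        + Γ (y q) (ds y q) (ds a q)) + Γ (y q) (ds y q) (ds a q + Γ (y q) (ds y q) (a q)) :=
    toCoord_covDeriv_covDeriv (h.contMDiff_slice_re hq) (h.contMDiff_slice hq) hx rfl rfl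
  have lb : toCoord x₀ (γ q.1 q.2)
      (covDeriv (fun s ↦ γ s q.2) (covDeriv (fun s ↦ γ s q.2) fun s ↦ (ψ s q.2).2) q.1) =
      ds (ds b) q + (fderiv ℝ Γ (y q) (ds y q) (ds y q) (b q) + Γ (y q) (ds (ds y) q) (b q)
        + Γ (y q) (ds y q) (ds b q)) + Γ (y q) (ds y q) (ds b q + Γ (y q) (ds y q) (b q)) :=
    toCoord_covDeriv_covDeriv (h.contMDiff_slice_im hq) (h.contMDiff_slice hq) hx rfl rfl
  have dta : toCoord x₀ (γ q.1 q.2) (covDeriv (fun t ↦ γ q.1 t) (fun t ↦ (ψ q.1 t).1) q.2) =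
      dt a q + Γ (y q) (dt y q) (a q) :=
    toCoord_covDeriv hx hcont ty.differentiableAt ta.differentiableAt
  have dtb : toCoord x₀ (γ q.1 q.2) (covDeriv (fun t ↦ γ q.1 t) (fun t ↦ (ψ q.1 t).2) q.2) =
      dt b q + Γ (y q) (dt y q) (b q) :=
    toCoord_covDeriv hx hcont ty.differentiableAt tb.differentiableAt
  have vt : toCoord x₀ (γ q.1 q.2) (velocity (fun t ↦ γ q.1 t) q.2) = dt y q :=
    toCoord_velocity (h.mdifferentiableAt_time hq h0) hx
  have vs : toCoord x₀ (γ q.1 q.2) (velocity (fun s ↦ γ s q.2) q.1) = ds y q :=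
    toCoord_velocity ((h.contMDiff_slice hq q.1).mdifferentiableAt (by simp)) hx
  have te : toCoord x₀ (γ q.1 q.2) (tension (fun s ↦ γ s q.2) q.1) =
      ds (ds y) q + Γ (y q) (ds y q) (ds y q) := toCoord_tension (h.contMDiff_slice hq) hx
  have ey : dt y q =
      ds (ds y) q + curveTerm κ ε Γ (y q) (a q) (b q) (ds y q) (ds a q) (ds b q) := by
    have e := congrArg (toCoord x₀ (γ q.1 q.2)) (h.evolution_curve q.1 q.2 hq h0)
    have kB : toCoord x₀ (γ q.1 q.2) (curvTerm (fun s ↦ γ s q.2) (fun s ↦ ψ s q.2) q.1) =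
        (1 / 2 : ℝ) • (localCurvature Γ (y q) (-b q) (a q) (ds y q)
          + localCurvature Γ (y q) (a q) (b q) (ds y q)) := by
      unfold curvTerm spinorCurvature
      rw [toCoord_smul, toCoord_add, toCoord_curvature hx, toCoord_curvature hx, vs]
      simp only [clifford, toCoord_neg]
      rfl
    have kC : toCoord x₀ (γ q.1 q.2) (curvTermC (fun s ↦ γ s q.2) (fun s ↦ ψ s q.2) q.1) =
        localCurvature Γ (y q) (ds a q + Γ (y q) (ds y q) (a q)) (a q) (ds y q)
          + localCurvature Γ (y q) (ds b q + Γ (y q) (ds y q) (b q)) (b q) (ds y q) := by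
      unfold curvTermC spinorCurvature
      rw [toCoord_add, toCoord_curvature hx, toCoord_curvature hx, vs, ← na, ← nb]
      rfl
    rw [vt, toCoord_sub, toCoord_sub, te, toCoord_smul, toCoord_smul, toCoord_smul, kB, kC] at e
    rw [e, curveTerm, add_sub_assoc, add_sub_assoc]
  -- Multiplication by i maps (a, b) to (-b, a). The Dirac term thus enters the real part with +1/ε
  -- and the derivative of b, the imaginary part with -1/ε and the derivative of a.
  have ea : dt a q = ds (ds a) q + (laplacianTerm Γ (y q) (a q) (ds y q) (ds a q)
      (curveTerm κ ε Γ (y q) (a q) (b q) (ds y q) (ds a q) (ds b q))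
      + (1 / ε) • (ds b q + Γ (y q) (ds y q) (b q))) := by
    have e := congrArg (fun v ↦ toCoord x₀ (γ q.1 q.2) v.1) (h.evolution_spinor q.1 q.2 hq h0)
    simp only [spinorCovDeriv, spinorLaplacian, dirac, clifford, Prod.fst_sub, Prod.smul_fst] at e
    rw [dta, toCoord_sub, toCoord_smul, toCoord_neg, la, nb, ey] at e
    rw [eq_sub_of_add_eq e, smul_neg, sub_neg_eq_add, add_sub_right_comm, add_laplacianTerm,
      add_assoc]
  have eb : dt b q = ds (ds b) q + (laplacianTerm Γ (y q) (b q) (ds y q) (ds b q)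
      (curveTerm κ ε Γ (y q) (a q) (b q) (ds y q) (ds a q) (ds b q))
      - (1 / ε) • (ds a q + Γ (y q) (ds y q) (a q))) := by
    have e := congrArg (fun v ↦ toCoord x₀ (γ q.1 q.2) v.2) (h.evolution_spinor q.1 q.2 hq h0)
    simp only [spinorCovDeriv, spinorLaplacian, dirac, clifford, Prod.snd_sub, Prod.smul_snd] at e
    rw [dtb, toCoord_sub, toCoord_smul, lb, na, ey] at e
    rw [eq_sub_of_add_eq e, sub_right_comm, add_laplacianTerm, add_sub_assoc]
  have hds := ds_ds_prodMk hJ (cy.prodMk ca) cb hq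
  have hds' := ds_ds_prodMk hJ cy ca hq
  have hdt : dt (coordState x₀ γ ψ) q = ((dt y q, dt a q), dt b q) :=
    ((ty.prodMk ta).prodMk tb).deriv
  rw [hdt, hz, hds.1, hds.2, hds'.1, hds'.2, ey, ea, eb]
  rfl

end IsSmoothSolution

end SolutionCoordinates

/-! ### Spinors over N as vectors in a Euclidean space. -/

section Embedding

variable {n m : ℕ} {N : Type*} [TopologicalSpace N] [ChartedSpace (EuclideanSpace ℝ (Fin n)) N]
  [IsManifold (𝓡 n) ∞ N]

/-- The image of a spinor under the differential of a map `e` into a Euclidean space, together with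
the image of its base point. -/
def embedState (e : N → EuclideanSpace ℝ (Fin m)) (P : Σ p : N, TwistedFibre n p) :
    (EuclideanSpace ℝ (Fin m) × EuclideanSpace ℝ (Fin m)) × EuclideanSpace ℝ (Fin m) :=
  ((e P.1, mfderiv (𝓡 n) (𝓡 m) e P.1 P.2.1), mfderiv (𝓡 n) (𝓡 m) e P.1 P.2.2)

theorem embedState_injective {e : N → EuclideanSpace ℝ (Fin m)} (he : Function.Injective e)
    (he' : ∀ p, Function.Injective (mfderiv (𝓡 n) (𝓡 m) e p)) :
    Function.Injective (embedState (n := n) e) := by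
  rintro ⟨p, v⟩ ⟨p', v'⟩ h
  have h1 : e p = e p' := congrArg (fun w ↦ w.1.1) h
  obtain rfl := he h1
  have h2 : v.1 = v'.1 := he' p (congrArg (fun w ↦ w.1.2) h)
  have h3 : v.2 = v'.2 := he' p (congrArg (fun w ↦ w.2) h)
  rw [Prod.ext h2 h3]

/-- A map into a Euclidean space in the chart around `x₀`. -/
def coordMap (e : N → EuclideanSpace ℝ (Fin m)) (x₀ : N) (y : EuclideanSpace ℝ (Fin n)) :
    EuclideanSpace ℝ (Fin m) :=
  e ((extChartAt (𝓡 n) x₀).symm y)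

variable {e : N → EuclideanSpace ℝ (Fin m)} {x₀ p : N}

theorem contDiffAt_coordMap (he : ContMDiff (𝓡 n) (𝓡 m) ∞ e) {y : EuclideanSpace ℝ (Fin n)}
    (hy : y ∈ (extChartAt (𝓡 n) x₀).target) : ContDiffAt ℝ ∞ (coordMap e x₀) y := by
  have h1 := (contMDiffOn_extChartAt_symm (I := 𝓡 n) (n := ∞) x₀).contMDiffAt
    ((isOpen_extChartAt_target x₀).mem_nhds hy)
  exact ((he _).comp y h1).contDiffAt

theorem fderiv_coordMap (he : ContMDiff (𝓡 n) (𝓡 m) ∞ e)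
    (hp : p ∈ (extChartAt (𝓡 n) x₀).source) (v : TangentSpace (𝓡 n) p) :
    fderiv ℝ (coordMap e x₀) (extChartAt (𝓡 n) x₀ p) (toCoord x₀ p v) =
      mfderiv (𝓡 n) (𝓡 m) e p v := by
  have hp' := hp
  rw [extChartAt_source] at hp'
  have h1 : MDifferentiableAt (𝓡 n) 𝓘(ℝ, EuclideanSpace ℝ (Fin n)) (extChartAt (𝓡 n) x₀) p :=
    mdifferentiableAt_extChartAt hp'
  have h2 : MDifferentiableAt 𝓘(ℝ, EuclideanSpace ℝ (Fin n)) (𝓡 m) (coordMap e x₀)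
      (extChartAt (𝓡 n) x₀ p) :=
    ((contDiffAt_coordMap he ((extChartAt (𝓡 n) x₀).map_source hp)).differentiableAt
      (by simp)).mdifferentiableAt
  have h3 : coordMap e x₀ ∘ extChartAt (𝓡 n) x₀ =ᶠ[𝓝 p] e := by
    filter_upwards [(isOpen_extChartAt_source x₀).mem_nhds hp] with x hx
    simp only [Function.comp, coordMap]
    rw [(extChartAt (𝓡 n) x₀).left_inv hx]
  have h4 := mfderiv_comp p h2 h1
  rw [toCoord_eq_mfderiv _ _ hp', ← mfderiv_eq_fderiv, ← h3.mfderiv_eq, h4]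
  rfl

theorem injective_fderiv_coordMap (he : ContMDiff (𝓡 n) (𝓡 m) ∞ e)
    (he' : ∀ p, Function.Injective (mfderiv (𝓡 n) (𝓡 m) e p))
    (hp : p ∈ (extChartAt (𝓡 n) x₀).source) :
    Function.Injective (fderiv ℝ (coordMap e x₀) (extChartAt (𝓡 n) x₀ p)) := by
  intro v w h
  rw [← toCoord_ofCoord hp v, ← toCoord_ofCoord hp w, fderiv_coordMap he hp,
    fderiv_coordMap he hp] at h
  rw [← toCoord_ofCoord hp v, ← toCoord_ofCoord hp w, he' p h]

/-- The map `embedState` in local coordinates, with values in a Euclidean space. -/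
def localEmbedding (e : N → EuclideanSpace ℝ (Fin m)) (x₀ : N)
    (z : (EuclideanSpace ℝ (Fin n) × EuclideanSpace ℝ (Fin n)) × EuclideanSpace ℝ (Fin n)) :=
  toEuclidean (fibrewise (fibrewise (coordMap e x₀) (fderiv ℝ (coordMap e x₀)))
    (fun w ↦ fderiv ℝ (coordMap e x₀) w.1) z)

theorem contDiffAt_localEmbedding_aux (he : ContMDiff (𝓡 n) (𝓡 m) ∞ e)
    {z : (EuclideanSpace ℝ (Fin n) × EuclideanSpace ℝ (Fin n)) × EuclideanSpace ℝ (Fin n)}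
    (hz : z.1.1 ∈ (extChartAt (𝓡 n) x₀).target) :
    ContDiffAt ℝ ∞ (fibrewise (coordMap e x₀) (fderiv ℝ (coordMap e x₀))) z.1 ∧
      ContDiffAt ℝ ∞ (fun w : EuclideanSpace ℝ (Fin n) × EuclideanSpace ℝ (Fin n) ↦
        fderiv ℝ (coordMap e x₀) w.1) z.1 := by
  have h := contDiffAt_coordMap he hz
  exact ⟨contDiffAt_fibrewise h h.fderiv_infty, h.fderiv_infty.comp z.1 contDiffAt_fst⟩

theorem contDiffAt_localEmbedding (he : ContMDiff (𝓡 n) (𝓡 m) ∞ e)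
    {z : (EuclideanSpace ℝ (Fin n) × EuclideanSpace ℝ (Fin n)) × EuclideanSpace ℝ (Fin n)}
    (hz : z.1.1 ∈ (extChartAt (𝓡 n) x₀).target) :
    ContDiffAt ℝ ∞ (localEmbedding e x₀) z := by
  obtain ⟨h1, h2⟩ := contDiffAt_localEmbedding_aux he hz
  exact toEuclidean.contDiff.contDiffAt.comp z (contDiffAt_fibrewise h1 h2)

/-- Two applications of the block triangular argument, one for each component of the spinor,
starting from the immersion `coordMap`. -/
theorem injective_fderiv_localEmbedding (he : ContMDiff (𝓡 n) (𝓡 m) ∞ e)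
    (he' : ∀ p, Function.Injective (mfderiv (𝓡 n) (𝓡 m) e p))
    {z : (EuclideanSpace ℝ (Fin n) × EuclideanSpace ℝ (Fin n)) × EuclideanSpace ℝ (Fin n)}
    (hz : z.1.1 ∈ (extChartAt (𝓡 n) x₀).target) :
    Function.Injective (fderiv ℝ (localEmbedding e x₀) z) := by
  obtain ⟨h1, h2⟩ := contDiffAt_localEmbedding_aux he hz
  have h := contDiffAt_coordMap he hz
  have hinj : Function.Injective (fderiv ℝ (coordMap e x₀) z.1.1) := by
    rw [← (extChartAt (𝓡 n) x₀).right_inv hz]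
    exact injective_fderiv_coordMap he he' ((extChartAt (𝓡 n) x₀).map_target hz)
  have h3 := injective_fderiv_fibrewise h1 h2
    (injective_fderiv_fibrewise h h.fderiv_infty hinj hinj) hinj
  have h4 : HasFDerivAt (localEmbedding e x₀) _ z :=
    toEuclidean.hasFDerivAt.comp z ((contDiffAt_fibrewise h1 h2).differentiableAt
      (by simp)).hasFDerivAt
  rw [h4.fderiv]
  exact toEuclidean.injective.comp h3

end Embedding

/-! ### The embedded flow and its heat operator. -/

section SolutionEmbedding

variable {n m : ℕ} {N : Type*} [TopologicalSpace N] [ChartedSpace (EuclideanSpace ℝ (Fin n)) N]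
  [IsManifold (𝓡 n) ∞ N] [RiemannianBundle (fun x : N ↦ TangentSpace (𝓡 n) x)]
  {σ : SpinStructure} {κ ε : ℝ} {T : EReal} {γ : ℝ → ℝ → N}
  {ψ : ∀ s t, TwistedFibre n (γ s t)} {x₀ : N} {q : ℝ × ℝ}
  {e : N → EuclideanSpace ℝ (Fin m)}

/-- A family of curves and spinors as a map into a Euclidean space. -/
def embedFlow (e : N → EuclideanSpace ℝ (Fin m)) (γ : ℝ → ℝ → N)
    (ψ : ∀ s t, TwistedFibre n (γ s t)) (q : ℝ × ℝ) :=
  toEuclidean (embedState e ⟨γ q.1 q.2, ψ q.1 q.2⟩)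

/-- The lower order terms of the flow in the ambient Euclidean space. -/
def ambientTerm {X G : Type*} [NormedAddCommGroup X] [NormedSpace ℝ X] [NormedAddCommGroup G]
    [NormedSpace ℝ G] (H : X → G) (F : X → X → X) (w : X × X) : G :=
  fderiv ℝ H w.1 (F w.1 w.2) - fderiv ℝ (fderiv ℝ H) w.1 w.2 w.2

theorem contDiffAt_ambientTerm {X G : Type*} [NormedAddCommGroup X] [NormedSpace ℝ X]
    [NormedAddCommGroup G] [NormedSpace ℝ G] {H : X → G} {F : X → X → X} {w : X × X}
    (hH : ContDiffAt ℝ ∞ H w.1) (hF : ContDiffAt ℝ ∞ (fun w : X × X ↦ F w.1 w.2) w) :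
    ContDiffAt ℝ ∞ (ambientTerm H F) w :=
  (contDiffAt_fderiv_comp_apply hH contDiffAt_fst hF).sub
    ((contDiffAt_fderiv_comp_apply hH.fderiv_infty contDiffAt_fst contDiffAt_snd).clm_apply
      contDiffAt_snd)

theorem embedFlow_eq (he : ContMDiff (𝓡 n) (𝓡 m) ∞ e)
    (hx : γ q.1 q.2 ∈ (extChartAt (𝓡 n) x₀).source) :
    embedFlow e γ ψ q = localEmbedding e x₀ (coordState x₀ γ ψ q) := by
  unfold embedFlow localEmbedding
  congr 1
  refine Prod.ext (Prod.ext ?_ ?_) ?_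
  · simp only [embedState, fibrewise, coordMap, coordState]
    rw [(extChartAt (𝓡 n) x₀).left_inv hx]
  · exact (fderiv_coordMap he hx _).symm
  · exact (fderiv_coordMap he hx _).symm

namespace IsSmoothSolution

theorem eventually_mem_source (h : IsSmoothSolution σ κ ε T γ ψ) (hq : q.2 ∈ timeInterval T)
    (hx : γ q.1 q.2 ∈ (extChartAt (𝓡 n) x₀).source) :
    ∀ᶠ r in 𝓝[univ ×ˢ timeInterval T] q, γ r.1 r.2 ∈ (extChartAt (𝓡 n) x₀).source :=
  (h.smooth_curve.continuousOn q ⟨mem_univ _, hq⟩).eventually_mem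
    ((isOpen_extChartAt_source x₀).mem_nhds hx)

theorem eventually_embedFlow_eq (h : IsSmoothSolution σ κ ε T γ ψ)
    (he : ContMDiff (𝓡 n) (𝓡 m) ∞ e) (hq : q.2 ∈ timeInterval T)
    (hx : γ q.1 q.2 ∈ (extChartAt (𝓡 n) x₀).source) :
    ∀ᶠ r in 𝓝[univ ×ˢ timeInterval T] q,
      embedFlow e γ ψ r = localEmbedding e x₀ (coordState x₀ γ ψ r) := by
  filter_upwards [h.eventually_mem_source hq hx] with r hr using embedFlow_eq he hr

theorem contDiffOn_embedFlow (h : IsSmoothSolution σ κ ε T γ ψ)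
    (he : ContMDiff (𝓡 n) (𝓡 m) ∞ e) :
    ContDiffOn ℝ ∞ (embedFlow e γ ψ) (univ ×ˢ timeInterval T) := by
  intro q hq
  have hx := mem_extChartAt_source (I := 𝓡 n) (γ q.1 q.2)
  refine ContDiffWithinAt.congr_of_eventuallyEq ?_ (h.eventually_embedFlow_eq he hq.2 hx)
    (embedFlow_eq he hx)
  exact (contDiffAt_localEmbedding he (mem_extChartAt_target (γ q.1 q.2))).comp_contDiffWithinAt q
    (h.contDiffWithinAt_coordState hq.2 hx)

theorem ds_embedFlow (h : IsSmoothSolution σ κ ε T γ ψ)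
    (he : ContMDiff (𝓡 n) (𝓡 m) ∞ e) (hq : q.2 ∈ timeInterval T)
    (hx : γ q.1 q.2 ∈ (extChartAt (𝓡 n) x₀).source) :
    ds (embedFlow e γ ψ) q = fderiv ℝ (localEmbedding e x₀) (coordState x₀ γ ψ q)
      (ds (coordState x₀ γ ψ) q) :=
  ds_comp ((contDiffAt_localEmbedding he
      ((extChartAt (𝓡 n) x₀).map_source hx)).differentiableAt (by simp))
    (hasDerivAt_slice (h.contDiffWithinAt_coordState hq hx) hq)
    (eventually_slice_fst (h.eventually_embedFlow_eq he hq hx) hq)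

variable [IsContMDiffRiemannianBundle (𝓡 n) ∞ (EuclideanSpace ℝ (Fin n))
      (fun x : N ↦ TangentSpace (𝓡 n) x)]

/-- For u = H(z) the chain rule gives u_t - u_ss = DH(z_t - z_ss) - D²H(z_s, z_s), and the
coordinate equation removes z_t - z_ss. -/
theorem dt_sub_ds_ds_embedFlow (h : IsSmoothSolution σ κ ε T γ ψ)
    (he : ContMDiff (𝓡 n) (𝓡 m) ∞ e) (hq : q.2 ∈ timeInterval T) (h0 : 0 < q.2)
    (hx : γ q.1 q.2 ∈ (extChartAt (𝓡 n) x₀).source) :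
    dt (embedFlow e γ ψ) q - ds (ds (embedFlow e γ ψ)) q =
      ambientTerm (localEmbedding e x₀) (flowTerm κ ε (christoffelMap x₀))
        (coordState x₀ γ ψ q, ds (coordState x₀ γ ψ) q) := by
  have hT : 0 < T := lt_of_le_of_lt (by exact_mod_cast hq.1) hq.2
  have hJq := timeInterval_mem_nhds hq h0
  have hH : ContDiffAt ℝ ∞ (localEmbedding e x₀) (coordState x₀ γ ψ q) :=
    contDiffAt_localEmbedding he ((extChartAt (𝓡 n) x₀).map_source hx)
  have hz := h.contDiffWithinAt_coordState hq hx
  have hu := h.eventually_embedFlow_eq he hq hx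
  have hu' : ∀ᶠ t in 𝓝 q.2, embedFlow e γ ψ (q.1, t) =
      localEmbedding e x₀ (coordState x₀ γ ψ (q.1, t)) := by
    rw [nhdsWithin_eq_nhds.2 (prod_mem_nhds univ_mem hJq)] at hu
    exact (continuous_const.prodMk continuous_id).continuousAt.eventually hu
  rw [dt_comp (hH.differentiableAt (by simp)) (hasDerivAt_slice_time hz hJq) hu',
    ds_ds_comp (uniqueDiffOn_timeInterval hT) hH hz hq hu, h.dt_coordState hq h0 hx, map_add,
    ambientTerm]
  abel

end IsSmoothSolution

theorem SpinStructure.sign_mul_self (σ : SpinStructure) : σ.sign * σ.sign = 1 := by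
  cases σ <;> simp [SpinStructure.sign]

/-- Going round the circle twice squares the sign, so both spin structures are handled on a cylinder
of circumference 4π. -/
theorem IsSmoothSolution.periodic_four_pi (h : IsSmoothSolution σ κ ε T γ ψ) (s : ℝ) {t : ℝ}
    (ht : t ∈ timeInterval T) :
    (⟨γ (s + 4 * Real.pi) t, ψ (s + 4 * Real.pi) t⟩ : Σ p : N, TwistedFibre n p) =
      ⟨γ s t, ψ s t⟩ := by
  have h1 := h.periodic (s + 2 * Real.pi) t ht
  have h2 := congrArg (fun P : Σ p : N, TwistedFibre n p ↦
    (⟨P.1, σ.sign • P.2⟩ : Σ p : N, TwistedFibre n p)) (h.periodic s t ht)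
  simp only [smul_smul, σ.sign_mul_self, one_smul] at h2
  rw [show s + 4 * Real.pi = s + 2 * Real.pi + 2 * Real.pi by ring, h1, h2]

variable [IsContMDiffRiemannianBundle (𝓡 n) ∞ (EuclideanSpace ℝ (Fin n))
      (fun x : N ↦ TangentSpace (𝓡 n) x)]

/-- Agreement of the embedded states and of their s-derivatives at q forces agreement of z and z_s
in one chart. Near q the heat operators are values of one smooth function at two nearby points (z,
z_s), and the immersion (z, p) ↦ (H(z), DH(z)p) bounds their difference by that of (u, u_s). -/
theorem exists_heat_operator_bound {γ₁ γ₂ : ℝ → ℝ → N} {ψ₁ : ∀ s t, TwistedFibre n (γ₁ s t)}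
    {ψ₂ : ∀ s t, TwistedFibre n (γ₂ s t)} (h₁ : IsSmoothSolution σ κ ε T γ₁ ψ₁)
    (h₂ : IsSmoothSolution σ κ ε T γ₂ ψ₂) (he : ContMDiff (𝓡 n) (𝓡 m) ∞ e)
    (hinj : Function.Injective e) (he' : ∀ p, Function.Injective (mfderiv (𝓡 n) (𝓡 m) e p))
    (hq : q.2 ∈ timeInterval T) (h0 : embedFlow e γ₁ ψ₁ q = embedFlow e γ₂ ψ₂ q)
    (h0' : ds (embedFlow e γ₁ ψ₁) q = ds (embedFlow e γ₂ ψ₂) q) :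
    ∃ C : ℝ, 0 ≤ C ∧ ∀ᶠ r in 𝓝[univ ×ˢ timeInterval T] q, 0 < r.2 →
      ‖(dt (embedFlow e γ₁ ψ₁) r - ds (ds (embedFlow e γ₁ ψ₁)) r)
        - (dt (embedFlow e γ₂ ψ₂) r - ds (ds (embedFlow e γ₂ ψ₂)) r)‖ ≤
      C * ‖(embedFlow e γ₁ ψ₁ r - embedFlow e γ₂ ψ₂ r,
        ds (embedFlow e γ₁ ψ₁) r - ds (embedFlow e γ₂ ψ₂) r)‖ := by
  have hT : 0 < T := lt_of_le_of_lt (by exact_mod_cast hq.1) hq.2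
  have hJ := uniqueDiffOn_timeInterval hT
  have hs : (⟨γ₁ q.1 q.2, ψ₁ q.1 q.2⟩ : Σ p : N, TwistedFibre n p) = ⟨γ₂ q.1 q.2, ψ₂ q.1 q.2⟩ :=
    embedState_injective hinj he' (toEuclidean.injective h0)
  set x₀ := γ₁ q.1 q.2 with hx₀
  have hγ : x₀ = γ₂ q.1 q.2 := congrArg Sigma.fst hs
  have hx₁ : γ₁ q.1 q.2 ∈ (extChartAt (𝓡 n) x₀).source := mem_extChartAt_source _
  have hx₂ : γ₂ q.1 q.2 ∈ (extChartAt (𝓡 n) x₀).source := hγ ▸ mem_extChartAt_source x₀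
  have hz : coordState x₀ γ₁ ψ₁ q = coordState x₀ γ₂ ψ₂ q :=
    congrArg (fun P : Σ p : N, TwistedFibre n p ↦
      ((extChartAt (𝓡 n) x₀ P.1, toCoord x₀ P.1 P.2.1), toCoord x₀ P.1 P.2.2)) hs
  have ht : (coordState x₀ γ₁ ψ₁ q).1.1 ∈ (extChartAt (𝓡 n) x₀).target :=
    (extChartAt (𝓡 n) x₀).map_source hx₁
  have hH : ContDiffAt ℝ ∞ (localEmbedding e x₀) (coordState x₀ γ₁ ψ₁ q) :=
    contDiffAt_localEmbedding he ht
  have hHinj := injective_fderiv_localEmbedding he he' ht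
  -- Injectivity of DH at the common state recovers z_s from u_s.
  have hp : ds (coordState x₀ γ₁ ψ₁) q = ds (coordState x₀ γ₂ ψ₂) q := by
    rw [h₁.ds_embedFlow he hq hx₁, h₂.ds_embedFlow he hq hx₂, ← hz] at h0'
    exact hHinj h0'
  set w₁ := fun r ↦ (coordState x₀ γ₁ ψ₁ r, ds (coordState x₀ γ₁ ψ₁) r) with hw₁
  set w₂ := fun r ↦ (coordState x₀ γ₂ ψ₂ r, ds (coordState x₀ γ₂ ψ₂) r) with hw₂
  have hw : w₁ q = w₂ q := Prod.ext hz hp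
  have c₁ : ContinuousWithinAt w₁ (univ ×ˢ timeInterval T) q :=
    (h₁.contDiffWithinAt_coordState hq hx₁).continuousWithinAt.prodMk
      (contDiffWithinAt_ds hJ (h₁.contDiffWithinAt_coordState hq hx₁) hq).continuousWithinAt
  have c₂ : ContinuousWithinAt w₂ (univ ×ˢ timeInterval T) q :=
    (h₂.contDiffWithinAt_coordState hq hx₂).continuousWithinAt.prodMk
      (contDiffWithinAt_ds hJ (h₂.contDiffWithinAt_coordState hq hx₂) hq).continuousWithinAt
  obtain ⟨C, hC, hC'⟩ := exists_norm_sub_le_of_immersion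
    (f := fibrewise (localEmbedding e x₀) (fderiv ℝ (localEmbedding e x₀)))
    (k := ambientTerm (localEmbedding e x₀) (flowTerm κ ε (christoffelMap x₀))) (x := w₁ q)
    (contDiffAt_fibrewise hH hH.fderiv_infty)
    (injective_fderiv_fibrewise hH hH.fderiv_infty hHinj hHinj)
    (contDiffAt_ambientTerm hH (contDiffAt_flowTerm (contDiffAt_christoffelMap ht)))
  refine ⟨C, hC, ?_⟩
  have c : Tendsto (fun r ↦ (w₁ r, w₂ r)) (𝓝[univ ×ˢ timeInterval T] q) (𝓝 (w₁ q, w₁ q)) := by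
    have := c₁.prodMk c₂
    rwa [ContinuousWithinAt, ← hw] at this
  filter_upwards [c.eventually hC', h₁.eventually_mem_source hq hx₁,
    h₂.eventually_mem_source hq hx₂, self_mem_nhdsWithin] with r hr hr₁ hr₂ hrS hr0
  rw [h₁.dt_sub_ds_ds_embedFlow he hrS.2 hr0 hr₁, h₂.dt_sub_ds_ds_embedFlow he hrS.2 hr0 hr₂,
    h₁.ds_embedFlow he hrS.2 hr₁, h₂.ds_embedFlow he hrS.2 hr₂, embedFlow_eq he hr₁,
    embedFlow_eq he hr₂]
  exact hr

theorem ds_sub {X : Type*} [NormedAddCommGroup X] [NormedSpace ℝ X] {J : Set ℝ}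
    (hJ : UniqueDiffOn ℝ J) {q : ℝ × ℝ} {f g : ℝ × ℝ → X}
    (hf : ContDiffWithinAt ℝ ∞ f (univ ×ˢ J) q) (hg : ContDiffWithinAt ℝ ∞ g (univ ×ˢ J) q)
    (hq : q.2 ∈ J) :
    ds (fun r ↦ f r - g r) q = ds f q - ds g q ∧
      ds (ds fun r ↦ f r - g r) q = ds (ds f) q - ds (ds g) q := by
  refine ⟨((hasDerivAt_slice hf hq).sub (hasDerivAt_slice hg hq)).deriv, ?_⟩
  rw [ds_congr (v := fun r ↦ ds f r - ds g r) _ hq]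
  · exact ((hasDerivAt_slice (contDiffWithinAt_ds hJ hf hq) hq).sub
      (hasDerivAt_slice (contDiffWithinAt_ds hJ hg hq) hq)).deriv
  · filter_upwards [eventually_hasDerivAt_slice hf hq, eventually_hasDerivAt_slice hg hq]
      with r h1 h2 using (h1.sub h2).deriv

end SolutionEmbedding

end DiracFlow

end

/-! ### The uniqueness theorem. -/

theorem mainTheorem4 {n : ℕ} {N : Type*} [TopologicalSpace N] [T2Space N] [CompactSpace N]
    [ChartedSpace (EuclideanSpace ℝ (Fin n)) N] [IsManifold (𝓡 n) ∞ N]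
    [RiemannianBundle (fun x : N ↦ TangentSpace (𝓡 n) x)]
    [IsContMDiffRiemannianBundle (𝓡 n) ∞ (EuclideanSpace ℝ (Fin n))
      (fun x : N ↦ TangentSpace (𝓡 n) x)]
    (σ : DiracFlow.SpinStructure) (κ : ℝ) (hκ : κ = 1 ∨ κ = -1) (ε : ℝ) (hε : 0 < ε)
    (T : EReal) (hT : 0 < T)
    (γ₁ : ℝ → ℝ → N) (ψ₁ : ∀ s t, DiracFlow.TwistedFibre n (γ₁ s t))
    (γ₂ : ℝ → ℝ → N) (ψ₂ : ∀ s t, DiracFlow.TwistedFibre n (γ₂ s t))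
    (h₁ : DiracFlow.IsSmoothSolution σ κ ε T γ₁ ψ₁)
    (h₂ : DiracFlow.IsSmoothSolution σ κ ε T γ₂ ψ₂)
    (h₀ : ∀ s, (⟨γ₁ s 0, ψ₁ s 0⟩ : Σ p : N, DiracFlow.TwistedFibre n p) = ⟨γ₂ s 0, ψ₂ s 0⟩) :
    ∀ s, ∀ t ∈ DiracFlow.timeInterval T,
      (⟨γ₁ s t, ψ₁ s t⟩ : Σ p : N, DiracFlow.TwistedFibre n p) = ⟨γ₂ s t, ψ₂ s t⟩ := by
  obtain ⟨m, e, he, hemb, he'⟩ := exists_embedding_euclidean_of_compact (I := 𝓡 n) (M := N)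
  have hinj := hemb.injective
  have hJ := DiracFlow.uniqueDiffOn_timeInterval hT
  have c₁ := h₁.contDiffOn_embedFlow he
  have c₂ := h₂.contDiffOn_embedFlow he
  -- The `toEuclidean` in `embedFlow` replaces the supremum norm of the product by one coming from
  -- an inner product, as the argument with |W|² demands.
  have hW := DiracFlow.eq_zero_of_heat_operator_bound
    (W := fun q ↦ DiracFlow.embedFlow e γ₁ ψ₁ q - DiracFlow.embedFlow e γ₂ ψ₂ q) hT
    (P := 4 * Real.pi) (by positivity) (c₁.sub c₂)
    (fun s t ht ↦ by
      simp only [DiracFlow.embedFlow]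
      rw [h₁.periodic_four_pi s ht, h₂.periodic_four_pi s ht])
    (fun s ↦ by
      simp only [DiracFlow.embedFlow]
      rw [h₀ s, sub_self])
    (fun q hq hq0 hq1 ↦ by
      have hqS : q ∈ Set.univ ×ˢ DiracFlow.timeInterval T := ⟨Set.mem_univ _, hq⟩
      rw [(DiracFlow.ds_sub hJ (c₁ q hqS) (c₂ q hqS) hq).1] at hq1
      obtain ⟨C, hC, hb⟩ := DiracFlow.exists_heat_operator_bound h₁ h₂ he hinj he' hq
        (sub_eq_zero.1 hq0) (sub_eq_zero.1 hq1)
      refine ⟨C, ?_⟩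
      filter_upwards [hb, self_mem_nhdsWithin] with r hr hrS hr0
      have hrJ := DiracFlow.timeInterval_mem_nhds hrS.2 hr0
      have e1 : DiracFlow.dt
          (fun q ↦ DiracFlow.embedFlow e γ₁ ψ₁ q - DiracFlow.embedFlow e γ₂ ψ₂ q) r =
          DiracFlow.dt (DiracFlow.embedFlow e γ₁ ψ₁) r
            - DiracFlow.dt (DiracFlow.embedFlow e γ₂ ψ₂) r :=
        ((DiracFlow.hasDerivAt_slice_time (c₁ r hrS) hrJ).sub
          (DiracFlow.hasDerivAt_slice_time (c₂ r hrS) hrJ)).deriv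
      have e2 := DiracFlow.ds_sub hJ (c₁ r hrS) (c₂ r hrS) hrS.2
      rw [e1, e2.1, e2.2, sub_sub_sub_comm]
      refine (hr hr0).trans (mul_le_mul_of_nonneg_left ?_ hC)
      -- The norm of the pair (W, W_s) is the maximum of the two norms, hence at most their sum.
      exact max_le (le_add_of_nonneg_right (norm_nonneg _)) (le_add_of_nonneg_left (norm_nonneg _)))
  intro s t ht
  exact DiracFlow.embedState_injective hinj he'
    (toEuclidean.injective (sub_eq_zero.1 (hW s t ht)))
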